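/- Let $k$ be an algebraically closed field and let $n\ge 3$. For a locally noetherian $k$-scheme $A$, let $\mathrm{Bir}_{\mathbb P^n}(A)$ be the set of $A$-birational transformations of $A\times\mathbb P^n$ that induce an isomorphism $U\to V$ between open subsets of $A\times\mathbb P^n$ whose projections to $A$ are surjective. For $f\in\mathrm{Bir}_{\mathbb P^n}(A)$ and a point $a$ of $A$ with residue field $\kappa(a)$, let $f_a\in \mathrm{Bir}_{\mathbb P^n}(\kappa(a))$ be the induced birational transformation of $\mathbb P^n_{\kappa(a)}$; its degree is the degree of the homogeneous polynomials without common factor that define it. Let $\mathrm{Bir}^{\mathrm{deg}}_{\mathbb P^n}(A)\subset \mathrm{Bir}_{\mathbb P^n}(A)$ be the set of the $f$ such that $a\mapsto \deg(f_a)$ is constant on the connected components of $A$. Let $\mathrm{Bir}^{\mathrm{flat}}_{\mathbb P^n}(A)\subset \mathrm{Bir}_{\mathbb P^n}(A)$ be the set of the $f$ whose graph $Y\subset A\times\mathbb P^n\times\mathbb P^n$ (the closure of $\{(a,x,f(a,x))\}$) is a flat family of birational transformations, that is, $Y$ is flat over $A$ and, for each $a\in A$, the fibre $Y_a$ is, as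 a closed subscheme, the graph of an element of $\mathrm{Bir}_{\mathbb P^n}(\kappa(a))$. Then the functors $\mathrm{Bir}^{\mathrm{flat}}_{\mathbb P^n}$ and $\mathrm{Bir}^{\mathrm{deg}}_{\mathbb P^n}$ are not equal: there is a locally noetherian $k$-scheme $A$ with $\mathrm{Bir}^{\mathrm{flat}}_{\mathbb P^n}(A)\ne \mathrm{Bir}^{\mathrm{deg}}_{\mathbb P^n}(A)$. More precisely, for $A=\mathbb A^1=\mathrm{Spec}\,k[t]$, the family of automorphisms of $\mathbb A^n$ $$\xi(t)\colon (x_1,\dots,x_n)\mapsto (x_1+x_2^2,\;x_2+t x_3^2,\;x_3,\dots,x_n)$$ extends (via $\mathbb A^n\subset\mathbb P^n$, $x\mapsto[1:x_1:\dots:x_n]$) to an element $\xi\in \mathrm{Bir}_{\mathbb P^n}(\mathbb A^1)$ such that: $\deg\xi(t)=2$ for all $t\in k$; $\deg \xi(t)^{-1}=4$ for all $t\in k\setminus\{0\}$, and $\deg\xi(0)^{-1}=2$; $\xi\in \mathrm{Bir}^{\mathrm{deg}}_{\mathbb P^n}(\mathbb A^1)$; $\xi^{-1}\notin \mathrm{Bir}^{\mathrm{deg}}_{\mathbb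 P^n}(\mathbb A^1)$ (the degree of the inverse is not constant); and $\xi\notin \mathrm{Bir}^{\mathrm{flat}}_{\mathbb P^n}(\mathbb A^1)$. -/

import Mathlib

open CategoryTheory CategoryTheory.Limits AlgebraicGeometry

universe u

noncomputable section

namespace BirFamilies

section Families

variable {X S A B : Scheme.{u}}

/-- A representative of an `A`-birational transformation of `A × X` (product over `S`):
an `A`-isomorphism `U ≅ V` between open subschemes of `A × X` whose projections to `A`
are surjective. -/
structure BirRep (πX : X ⟶ S) (πA : A ⟶ S) where
  /-- the open subscheme `U` -/
  source : (pullback πA πX).Opens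
  /-- the open subscheme `V` -/
  target : (pullback πA πX).Opens
  /-- the isomorphism `U ≅ V` -/
  iso : source.toScheme ≅ target.toScheme
  isOver : iso.hom ≫ target.ι ≫ pullback.fst πA πX = source.ι ≫ pullback.fst πA πX
  surj_source : Surjective (source.ι ≫ pullback.fst πA πX)
  surj_target : Surjective (target.ι ≫ pullback.fst πA πX)

namespace BirRep

variable {πX : X ⟶ S} {πA : A ⟶ S}

/-- The transformation as a morphism `U ⟶ A × X`. -/
def hom (φ : BirRep πX πA) : φ.source.toScheme ⟶ pullback πA πX :=
  φ.iso.hom ≫ φ.target.ι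

instance isOpenImmersion_hom (φ : BirRep πX πA) : IsOpenImmersion φ.hom := by
  unfold hom; infer_instance

lemma hom_fst (φ : BirRep πX πA) :
    φ.hom ≫ pullback.fst πA πX = φ.source.ι ≫ pullback.fst πA πX := by
  rw [hom, Category.assoc, φ.isOver]

/-- Two representatives define the same `A`-birational transformation if they agree on an open
subscheme of `A × X` whose projection to `A` is surjective. If the fibres of `A × X ⟶ A` are
irreducible (as they are for `X` an irreducible variety over an algebraically closed field),
such open subschemes are the ones that are dense in every fibre, and this is an equivalence
relation. -/
def Rel (φ ψ : BirRep πX πA) : Prop :=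
  ∃ (W : (pullback πA πX).Opens) (h₁ : W ≤ φ.source) (h₂ : W ≤ ψ.source),
    Surjective (W.ι ≫ pullback.fst πA πX) ∧
      (pullback πA πX).homOfLE h₁ ≫ φ.hom = (pullback πA πX).homOfLE h₂ ≫ ψ.hom

/-- The inverse transformation `V ≅ U`. -/
def inv (φ : BirRep πX πA) : BirRep πX πA where
  source := φ.target
  target := φ.source
  iso := φ.iso.symm
  isOver := by
    rw [Iso.symm_hom, ← φ.isOver, Iso.inv_hom_id_assoc]
  surj_source := φ.surj_target
  surj_target := φ.surj_source

lemma inv_rel {φ ψ : BirRep πX πA} (h : Rel φ ψ) : Rel φ.inv ψ.inv := by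
  obtain ⟨W, h₁, h₂, hs, e⟩ := h
  have key : ∀ (θ : BirRep πX πA) (hW : W ≤ θ.source) (q : W.toScheme ⟶ pullback πA πX)
      [IsOpenImmersion q], q = (pullback πA πX).homOfLE hW ≫ θ.hom →
      ∃ h' : q.opensRange ≤ θ.inv.source,
        (pullback πA πX).homOfLE h' ≫ θ.inv.hom = q.isoOpensRange.inv ≫ W.ι := by
    intro θ hW q _ hq
    have h' : q.opensRange ≤ θ.target := by
      rintro x ⟨y, rfl⟩
      rw [hq, hom, ← Category.assoc, Scheme.Hom.comp_apply]
      exact (((pullback πA πX).homOfLE hW ≫ θ.iso.hom) y).2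
    refine ⟨h', ?_⟩
    rw [Iso.eq_inv_comp]
    have : q.isoOpensRange.hom ≫ (pullback πA πX).homOfLE h' =
        (pullback πA πX).homOfLE hW ≫ θ.iso.hom := by
      rw [← cancel_mono θ.target.ι]
      simp only [Category.assoc, Scheme.homOfLE_ι, Scheme.Hom.isoOpensRange_hom_ι]
      exact hq
    change q.isoOpensRange.hom ≫ (pullback πA πX).homOfLE h' ≫ θ.iso.inv ≫ θ.source.ι = _
    rw [reassoc_of% this, Iso.hom_inv_id_assoc, Scheme.homOfLE_ι]
  let q := (pullback πA πX).homOfLE h₁ ≫ φ.hom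
  obtain ⟨a₁, b₁⟩ := key φ h₁ q rfl
  obtain ⟨a₂, b₂⟩ := key ψ h₂ q e
  refine ⟨q.opensRange, a₁, a₂, ?_, b₁.trans b₂.symm⟩
  have : q.opensRange.ι ≫ pullback.fst πA πX =
      q.isoOpensRange.inv ≫ W.ι ≫ pullback.fst πA πX := by
    rw [Iso.eq_inv_comp, ← Category.assoc, Scheme.Hom.isoOpensRange_hom_ι, Category.assoc,
      hom_fst, Scheme.homOfLE_ι_assoc]
  rw [this]
  infer_instance

end BirRep

/-- The map `B × X ⟶ A × X` induced by `g : B ⟶ A`. -/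
def prodMap (πX : X ⟶ S) (πA : A ⟶ S) (g : B ⟶ A) : pullback (g ≫ πA) πX ⟶ pullback πA πX :=
  pullback.map (g ≫ πA) πX πA πX g (𝟙 X) (𝟙 S) (by simp) (by simp)

@[simp] lemma prodMap_fst (πX : X ⟶ S) (πA : A ⟶ S) (g : B ⟶ A) :
    prodMap πX πA g ≫ pullback.fst πA πX = pullback.fst (g ≫ πA) πX ≫ g :=
  pullback.lift_fst _ _ _

@[simp] lemma prodMap_snd (πX : X ⟶ S) (πA : A ⟶ S) (g : B ⟶ A) :
    prodMap πX πA g ≫ pullback.snd πA πX = pullback.snd (g ≫ πA) πX :=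
  (pullback.lift_snd _ _ _).trans (Category.comp_id _)

lemma prodMap_isPullback (πX : X ⟶ S) (πA : A ⟶ S) (g : B ⟶ A) :
    IsPullback (prodMap πX πA g) (pullback.fst (g ≫ πA) πX) (pullback.fst πA πX) g := by
  refine IsPullback.of_right (h₁₂ := pullback.snd πA πX) (h₂₂ := πA) (v₁₃ := πX) ?_
    (prodMap_fst πX πA g) (IsPullback.of_hasPullback πA πX).flip
  rw [prodMap_snd]
  exact (IsPullback.of_hasPullback (g ≫ πA) πX).flip

lemma surjective_preimage (πX : X ⟶ S) (πA : A ⟶ S) (g : B ⟶ A) (U : (pullback πA πX).Opens)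
    (h : Surjective (U.ι ≫ pullback.fst πA πX)) :
    Surjective ((prodMap πX πA g ⁻¹ᵁ U).ι ≫ pullback.fst (g ≫ πA) πX) := by
  have := (isPullback_morphismRestrict (prodMap πX πA g) U).paste_vert (prodMap_isPullback πX πA g)
  exact MorphismProperty.of_isPullback this h

namespace BirRep

variable {πX : X ⟶ S} {πA : A ⟶ S}

/-- The base change of `φ` along `g : B ⟶ A`, as a morphism to `B × X`: `(b, x) ↦ (b, φ(g b, x))`. -/
def pullHom (φ : BirRep πX πA) (g : B ⟶ A) :
    (prodMap πX πA g ⁻¹ᵁ φ.source).toScheme ⟶ pullback (g ≫ πA) πX :=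
  (prodMap_isPullback πX πA g).lift ((prodMap πX πA g ∣_ φ.source) ≫ φ.hom)
    ((prodMap πX πA g ⁻¹ᵁ φ.source).ι ≫ pullback.fst (g ≫ πA) πX) (by
      rw [Category.assoc, hom_fst, morphismRestrict_ι_assoc, prodMap_fst, Category.assoc])

lemma pullHom_prodMap (φ : BirRep πX πA) (g : B ⟶ A) :
    φ.pullHom g ≫ prodMap πX πA g = (prodMap πX πA g ∣_ φ.source) ≫ φ.hom :=
  (prodMap_isPullback πX πA g).lift_fst _ _ _

lemma pullHom_fst (φ : BirRep πX πA) (g : B ⟶ A) :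
    φ.pullHom g ≫ pullback.fst (g ≫ πA) πX =
      (prodMap πX πA g ⁻¹ᵁ φ.source).ι ≫ pullback.fst (g ≫ πA) πX :=
  (prodMap_isPullback πX πA g).lift_snd _ _ _

instance isOpenImmersion_pullHom (φ : BirRep πX πA) (g : B ⟶ A) :
    IsOpenImmersion (φ.pullHom g) := by
  have h := (isPullback_morphismRestrict (prodMap πX πA g) φ.source).paste_vert
    (prodMap_isPullback πX πA g)
  rw [← hom_fst, ← pullHom_fst] at h
  have h' := IsPullback.of_bot h (φ.pullHom_prodMap g).symm (prodMap_isPullback πX πA g)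
  exact MorphismProperty.of_isPullback h' (inferInstanceAs (IsOpenImmersion φ.hom))

/-- The base change of a representative along `g : B ⟶ A`. -/
def pull (φ : BirRep πX πA) (g : B ⟶ A) : BirRep πX (g ≫ πA) where
  source := prodMap πX πA g ⁻¹ᵁ φ.source
  target := (φ.pullHom g).opensRange
  iso := (φ.pullHom g).isoOpensRange
  isOver := by
    rw [Scheme.Hom.isoOpensRange_hom_ι_assoc, pullHom_fst]
  surj_source := surjective_preimage πX πA g _ φ.surj_source
  surj_target := by
    have h : (φ.pullHom g).opensRange.ι ≫ pullback.fst (g ≫ πA) πX =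
        (φ.pullHom g).isoOpensRange.inv ≫
          (prodMap πX πA g ⁻¹ᵁ φ.source).ι ≫ pullback.fst (g ≫ πA) πX := by
      rw [Iso.eq_inv_comp, Scheme.Hom.isoOpensRange_hom_ι_assoc, pullHom_fst]
    have := surjective_preimage πX πA g _ φ.surj_source
    rw [h]
    infer_instance

lemma pull_hom (φ : BirRep πX πA) (g : B ⟶ A) : (φ.pull g).hom = φ.pullHom g :=
  (φ.pullHom g).isoOpensRange_hom_ι

lemma pull_rel {φ ψ : BirRep πX πA} (g : B ⟶ A) (h : Rel φ ψ) : Rel (φ.pull g) (ψ.pull g) := by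
  obtain ⟨W, h₁, h₂, hs, e⟩ := h
  refine ⟨prodMap πX πA g ⁻¹ᵁ W, (prodMap πX πA g).preimage_mono h₁, (prodMap πX πA g).preimage_mono h₂,
    surjective_preimage πX πA g _ hs, ?_⟩
  have key : ∀ (θ : BirRep πX πA) (hW : W ≤ θ.source),
      (pullback (g ≫ πA) πX).homOfLE ((prodMap πX πA g).preimage_mono hW) ≫ θ.pullHom g ≫
        prodMap πX πA g = (prodMap πX πA g ∣_ W) ≫ (pullback πA πX).homOfLE hW ≫ θ.hom := by
    intro θ hW
    rw [pullHom_prodMap, ← Category.assoc, ← Category.assoc]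
    congr 1
    rw [← cancel_mono θ.source.ι]
    simp
  have key' : (pullback (g ≫ πA) πX).homOfLE ((prodMap πX πA g).preimage_mono h₁) ≫
      φ.pullHom g = (pullback (g ≫ πA) πX).homOfLE ((prodMap πX πA g).preimage_mono h₂) ≫
      ψ.pullHom g := by
    apply (prodMap_isPullback πX πA g).hom_ext
    · rw [Category.assoc, Category.assoc, key φ h₁, key ψ h₂, e]
    · rw [Category.assoc, Category.assoc, pullHom_fst, pullHom_fst, Scheme.homOfLE_ι_assoc,
        Scheme.homOfLE_ι_assoc]
  exact (congrArg _ (pull_hom φ g)).trans (key'.trans (congrArg _ (pull_hom ψ g)).symm)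

/-- The graph `(a, x) ↦ (a, x, φ(a, x))` as a morphism `U ⟶ A × X × X = (A × X) ×_A (A × X)`. -/
def graphMap (φ : BirRep πX πA) :
    φ.source.toScheme ⟶ pullback (pullback.fst πA πX) (pullback.fst πA πX) :=
  pullback.lift φ.source.ι φ.hom φ.hom_fst.symm

/-- The graph of the transformation, as a closed subscheme of `A × X × X` (given by its ideal
sheaf): the (scheme-theoretic) closure of `{(a, x, φ(a, x))}`. -/
def graph (φ : BirRep πX πA) :
    (pullback (pullback.fst πA πX) (pullback.fst πA πX)).IdealSheafData :=
  φ.graphMap.ker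

end BirRep

/-- `Bir_X(A)`: the set of `A`-birational transformations of `A × X` that induce an isomorphism
between open subsets with surjective projections to `A`. -/
def Bir (πX : X ⟶ S) (πA : A ⟶ S) : Type u :=
  Quot (BirRep.Rel (πX := πX) (πA := πA))

namespace Bir

variable {πX : X ⟶ S} {πA : A ⟶ S}

/-- The class of a representative. -/
def mk (φ : BirRep πX πA) : Bir πX πA := Quot.mk _ φ

/-- The inverse of an `A`-birational transformation. -/
def inv : Bir πX πA → Bir πX πA :=
  Quot.map BirRep.inv fun _ _ ↦ BirRep.inv_rel

/-- The functoriality `Bir_X(A) → Bir_X(B)` along `g : B ⟶ A`. If `B` is the spectrum of a field,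
this is the member of the family at the point `g`. -/
def pull (f : Bir πX πA) (g : B ⟶ A) : Bir πX (g ≫ πA) :=
  Quot.map (fun φ ↦ BirRep.pull φ g) (fun _ _ ↦ BirRep.pull_rel g) f

end Bir

/-- The map `B × X × X ⟶ A × X × X` induced by `g : B ⟶ A`. -/
def prodMap₂ (πX : X ⟶ S) (πA : A ⟶ S) (g : B ⟶ A) :
    pullback (pullback.fst (g ≫ πA) πX) (pullback.fst (g ≫ πA) πX) ⟶
      pullback (pullback.fst πA πX) (pullback.fst πA πX) :=
  pullback.map _ _ _ _ (prodMap πX πA g) (prodMap πX πA g) g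
    (prodMap_fst πX πA g).symm (prodMap_fst πX πA g).symm

/-- A closed subscheme `Y` of `A × X × X` is a flat family of birational transformations of `X`
if it is flat over `A` and, for every point `a` of `A`, the fibre `Y_a ⊆ (X × X)_{κ(a)}` is, as
a closed subscheme, the graph of an element of `Bir_X(κ(a))`. -/
def IsFlatFamily (πX : X ⟶ S) (πA : A ⟶ S)
    (Y : (pullback (pullback.fst πA πX) (pullback.fst πA πX)).IdealSheafData) : Prop :=
  Flat (Y.subschemeι ≫ pullback.fst (pullback.fst πA πX) (pullback.fst πA πX) ≫
      pullback.fst πA πX) ∧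
    ∀ a : A, ∃ ψ : BirRep πX (A.fromSpecResidueField a ≫ πA),
      Y.comap (prodMap₂ πX πA (A.fromSpecResidueField a)) = ψ.graph

/-- `Bir_X^flat(A)`: the elements of `Bir_X(A)` whose graph is a flat family of birational
transformations. -/
def birFlat (πX : X ⟶ S) (πA : A ⟶ S) : Set (Bir πX πA) :=
  {f | ∃ φ : BirRep πX πA, Bir.mk φ = f ∧ IsFlatFamily πX πA φ.graph}

end Families

section ProjectiveSpace

attribute [local instance] MvPolynomial.gradedAlgebra

variable (n : ℕ) (k : Type u) [Field k]

/-- Projective space `ℙⁿ` over `k`, with homogeneous coordinates `x_0, …, x_n`. -/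
def ProjSpace : Scheme.{u} :=
  Proj (MvPolynomial.homogeneousSubmodule (Fin (n + 1)) k)

/-- The structure morphism `ℙⁿ ⟶ Spec k`. -/
def ProjSpace.str : ProjSpace n k ⟶ Spec (.of k) :=
  Proj.toSpecZero (MvPolynomial.homogeneousSubmodule (Fin (n + 1)) k) ≫
    Spec.map (CommRingCat.ofHom
      (algebraMap k (MvPolynomial.homogeneousSubmodule (Fin (n + 1)) k 0)))

variable {n k} {R : Type u} [CommRing R]

/-- The homomorphism `k[x_0, …, x_n] → R` with `x_i ↦ v_i` that extends `c : k → R`, with values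
in the global sections of `Spec R`. -/
def coordHom (c : k →+* R) (v : Fin (n + 1) → R) :
    MvPolynomial (Fin (n + 1)) k →+* Γ(Spec (.of R), ⊤) :=
  (Scheme.ΓSpecIso (.of R)).inv.hom.comp (MvPolynomial.eval₂Hom c v)

lemma coordHom_irrelevant (c : k →+* R) (v : Fin (n + 1) → R)
    (hv : Ideal.span (Set.range v) = ⊤) :
    (HomogeneousIdeal.irrelevant
      (MvPolynomial.homogeneousSubmodule (Fin (n + 1)) k)).toIdeal.map (coordHom c v) = ⊤ := by
  rw [coordHom, ← Ideal.map_map, ← top_le_iff, ← Ideal.map_top (Scheme.ΓSpecIso (.of R)).inv.hom]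
  refine Ideal.map_mono ?_
  rw [← hv, Ideal.span_le]
  rintro _ ⟨i, rfl⟩
  have h : MvPolynomial.X i ∈ (HomogeneousIdeal.irrelevant
      (MvPolynomial.homogeneousSubmodule (Fin (n + 1)) k)).toIdeal := by
    refine (HomogeneousIdeal.mem_irrelevant_iff _ _).mpr ?_
    rw [GradedRing.proj_apply]
    exact DirectSum.decompose_of_mem_ne _
      ((MvPolynomial.mem_homogeneousSubmodule _ _).mpr (MvPolynomial.isHomogeneous_X k i))
      one_ne_zero
  have := Ideal.mem_map_of_mem (MvPolynomial.eval₂Hom c v) h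
  rwa [MvPolynomial.coe_eval₂Hom, MvPolynomial.eval₂_X] at this

/-- The `R`-valued point `[v_0 : ⋯ : v_n]` of `ℙⁿ`, for `v_0, …, v_n ∈ R` generating the unit
ideal (`R` is a `k`-algebra via `c`). -/
def projPoint (c : k →+* R) (v : Fin (n + 1) → R) (hv : Ideal.span (Set.range v) = ⊤) :
    Spec (.of R) ⟶ ProjSpace n k :=
  Proj.fromOfGlobalSections _ (coordHom c v) (coordHom_irrelevant c v hv)

lemma span_cons_one (v : Fin n → R) :
    Ideal.span (Set.range (Fin.cons 1 v : Fin (n + 1) → R)) = ⊤ :=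
  (Ideal.eq_top_iff_one _).mpr (Ideal.subset_span ⟨0, rfl⟩)

/-- For a field `K` over `k` (via `s`): the birational transformation `f` of `ℙⁿ_K` is given by
`[x_0 : ⋯ : x_n] ↦ [F_0(x) : ⋯ : F_n(x)]`, i.e. `f([v]) = [F_0(v) : ⋯ : F_n(v)]` for each point
`[v]` of the domain of `f`, with coordinates `v` in any field extension `L` of `K`, such that
`F(v) ≠ 0`. (A vector over a field generates the unit ideal if and only if it is not zero.) -/
def IsGivenBy {K : CommRingCat.{u}} {s : Spec K ⟶ Spec (.of k)} (f : Bir (ProjSpace.str n k) s)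
    (F : Fin (n + 1) → MvPolynomial (Fin (n + 1)) K) : Prop :=
  ∃ φ : BirRep (ProjSpace.str n k) s, Bir.mk φ = f ∧
    ∀ (L : Type u) [Field L] (e : K →+* L) (v : Fin (n + 1) → L)
      (hv : Ideal.span (Set.range v) = ⊤)
      (hF : Ideal.span (Set.range fun i ↦ (F i).eval₂ e v) = ⊤)
      (p : Spec (.of L) ⟶ φ.source.toScheme),
      p ≫ φ.source.ι ≫ pullback.fst s (ProjSpace.str n k) = Spec.map (CommRingCat.ofHom e) →
      p ≫ φ.source.ι ≫ pullback.snd s (ProjSpace.str n k) =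
        projPoint (e.comp (Spec.preimage s).hom) v hv →
      p ≫ φ.hom ≫ pullback.snd s (ProjSpace.str n k) =
        projPoint (e.comp (Spec.preimage s).hom) (fun i ↦ (F i).eval₂ e v) hF

/-- For a field `K` over `k` (via `s`): the birational transformation `f` of `ℙⁿ_K` has degree `d`,
that is, it is given by homogeneous polynomials of degree `d` without common factor. -/
def HasDegree {K : CommRingCat.{u}} {s : Spec K ⟶ Spec (.of k)} (f : Bir (ProjSpace.str n k) s)
    (d : ℕ) : Prop :=
  ∃ F : Fin (n + 1) → MvPolynomial (Fin (n + 1)) K,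
    (∀ i, (F i).IsHomogeneous d) ∧ (∀ h, (∀ i, h ∣ F i) → IsUnit h) ∧ IsGivenBy f F

/-- `Bir_{ℙⁿ}^deg(A)`: the families of birational transformations of `ℙⁿ` whose degree is constant
on the connected components of `A`. -/
def birDeg {A : Scheme.{u}} (πA : A ⟶ Spec (.of k)) : Set (Bir (ProjSpace.str n k) πA) :=
  {f | ∀ x : A, ∃ d : ℕ, ∀ a ∈ connectedComponent x,
    HasDegree (f.pull (A.fromSpecResidueField a)) d}

variable (k) in
/-- The affine line `𝔸¹ = Spec k[t]`. -/
def Line : Scheme.{u} := Spec (.of (Polynomial k))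

variable (k) in
/-- The structure morphism `𝔸¹ ⟶ Spec k`. -/
def Line.str : Line k ⟶ Spec (.of k) :=
  Spec.map (CommRingCat.ofHom (algebraMap k (Polynomial k)))

/-- The `k`-point `t` of `𝔸¹`. -/
def Line.pt (t : k) : Spec (.of k) ⟶ Line k :=
  Spec.map (CommRingCat.ofHom (Polynomial.evalRingHom t))

/-- The family `f` of birational transformations of `ℙⁿ` over `𝔸¹` extends the family of
polynomial maps `x ↦ (p_1(t, x), …, p_n(t, x))` of `𝔸ⁿ`: it is defined on the image of
`𝔸¹ × 𝔸ⁿ ⟶ 𝔸¹ × ℙⁿ`, `(t, x) ↦ (t, [1 : x_1 : ⋯ : x_n])`, and sends the point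
`(t, [1 : x_1 : ⋯ : x_n])` to `(t, [1 : p_1(t, x) : ⋯ : p_n(t, x)])`. -/
def ExtendsAffineFamily (f : Bir (ProjSpace.str n k) (Line.str k))
    (p : Fin n → MvPolynomial (Fin n) (Polynomial k)) : Prop :=
  ∃ φ : BirRep (ProjSpace.str n k) (Line.str k), Bir.mk φ = f ∧
    ∃ j : Spec (.of (MvPolynomial (Fin n) (Polynomial k))) ⟶ φ.source.toScheme,
      j ≫ φ.source.ι ≫ pullback.fst (Line.str k) (ProjSpace.str n k) =
        Spec.map (CommRingCat.ofHom MvPolynomial.C) ∧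
      j ≫ φ.source.ι ≫ pullback.snd (Line.str k) (ProjSpace.str n k) =
        projPoint (algebraMap k _) (Fin.cons 1 MvPolynomial.X) (span_cons_one _) ∧
      j ≫ φ.hom ≫ pullback.snd (Line.str k) (ProjSpace.str n k) =
        projPoint (algebraMap k _) (Fin.cons 1 p) (span_cons_one _)

variable (k) in
/-- The family `(x_1, …, x_n) ↦ (x_1 + x_2 ^ 2, x_2 + t x_3 ^ 2, x_3, …, x_n)` of polynomial maps
of `𝔸ⁿ`; the variable `x_i` is `X (i - 1)`. -/
def xiPoly (hn : 3 ≤ n) (i : Fin n) : MvPolynomial (Fin n) (Polynomial k) :=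
  if i.val = 0 then MvPolynomial.X i + MvPolynomial.X ⟨1, by omega⟩ ^ 2
  else if i.val = 1 then
    MvPolynomial.X i + MvPolynomial.C Polynomial.X * MvPolynomial.X ⟨2, by omega⟩ ^ 2
  else MvPolynomial.X i

end ProjectiveSpace

end BirFamilies

end

/-! The substitution `ξ(t)` is an automorphism of affine space for every `t`. Its inverse is `(x_1 -
(x_2 - t x_3^2)^2, x_2 - t x_3^2, x_3, …)`. Homogenizing `ξ(t)` gives quadrics. Homogenizing the
inverse gives quartics when `t ≠ 0`, because of the term `-t^2 x_3^4`, and quadrics when `t = 0`.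
None of these tuples has a common factor: the coordinate with index `0` is a power of `x_0`, and
some other coordinate does not vanish identically on `x_0 = 0`. This gives the degrees at all points
of the line (`hasDegree_pull`, `hasDegree_pull_inv`). That the degree of the inverse is not constant
also needs the degree to be well defined (`HasDegree.unique`): two tuples without common factor that
describe the same map are proportional at the generic point, so they have the same degree.

The graph of `ξ` is not a flat family because its fibre at `t = 0` is too large to be a graph. This
fibre contains the graph of `ξ(0)`, on which `x_2 / x_3` is the same for a point and its image,
since `ξ(0)` fixes both coordinates (`ratio_eq_of_graphMap`). But `ξ(t)` sends `(0, 0, 1/t, 0, …)`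
to `(0, 1/t, 1/t, 0, …)`, so as `t` tends to `0` the closure of the graph acquires the pair
`([0:0:0:1:0:…], [0:0:1:1:0:…])`, at which the two ratios are `0` and `1`
(`graphCurve_mem_closure`). If the fibre were the graph of some `ψ`, then `ψ` would agree with
`ξ(0)` on a dense open set, since a graph is closed over the domain of definition
(`mem_range_graphMap`). The ratios would then agree on a dense part of the graph of `ψ`, whereas
differing ratios are an open condition (`exists_opens_ne`) that holds at the limit pair; this is the
contradiction in `not_preimage_subset`. -/

noncomputable section

namespace BirFamilies

attribute [local instance] MvPolynomial.gradedAlgebra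

/-! ### The coordinate rings of the standard charts of `ℙⁿ`. -/

section Away

open MvPolynomial

variable {n : ℕ} {k : Type u} [Field k] {R : Type u} [CommRing R]

/-- The values of a homogeneous polynomial scale by the power of the degree. -/
lemma eval₂_smul_of_isHomogeneous {σ K L : Type*} [CommSemiring K] [CommSemiring L]
    (e : K →+* L) (c : L) (v : σ → L) {f : MvPolynomial σ K} {d : ℕ} (hf : f.IsHomogeneous d) :
    f.eval₂ e (fun i ↦ c * v i) = c ^ d * f.eval₂ e v := by
  classical
  rw [eval₂_eq, eval₂_eq, Finset.mul_sum]
  refine Finset.sum_congr rfl fun s hs ↦ ?_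
  have hd : ∑ i ∈ s.support, s i = d := by
    have := hf (mem_support_iff.mp hs)
    rw [Finsupp.weight_apply, Finsupp.sum] at this
    simpa using this
  rw [Finset.prod_congr rfl fun i _ ↦ mul_pow c (v i) (s i), Finset.prod_mul_distrib,
    Finset.prod_pow_eq_pow_sum, hd]
  ring

/-- The homogeneous coordinate ring of `ℙⁿ` localized at `x_i`, in degree `0`. -/
abbrev ChartRing (k : Type u) [Field k] (i : Fin (n + 1)) : Type u :=
  HomogeneousLocalization.Away (homogeneousSubmodule (Fin (n + 1)) k) (X i)

lemma X_mem (k : Type u) [Field k] (i : Fin (n + 1)) :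
    (X i : MvPolynomial (Fin (n + 1)) k) ∈ homogeneousSubmodule (Fin (n + 1)) k 1 :=
  (mem_homogeneousSubmodule _ _).mpr (isHomogeneous_X k i)

/-- The function `x_j / x_i`. -/
def ratio (k : Type u) [Field k] (i j : Fin (n + 1)) : ChartRing k i :=
  HomogeneousLocalization.Away.mk _ (X_mem k i) 1 (X j) (X_mem k j)

/-- The constants in the chart ring. -/
def chartConst (k : Type u) [Field k] (i : Fin (n + 1)) : k →+* ChartRing k i :=
  (HomogeneousLocalization.fromZeroRingHom _ _).comp
    (algebraMap k (homogeneousSubmodule (Fin (n + 1)) k 0))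

/-- The homogeneous coordinate ring of `ℙⁿ` localized at `x_i`. -/
abbrev CoordLoc (k : Type u) [Field k] (i : Fin (n + 1)) : Type u :=
  Localization.Away (X i : MvPolynomial (Fin (n + 1)) k)

/-- The localization map. -/
abbrev toCoordLoc (k : Type u) [Field k] (i : Fin (n + 1)) :
    MvPolynomial (Fin (n + 1)) k →+* CoordLoc k i :=
  algebraMap _ _

lemma val_chartConst (i : Fin (n + 1)) (a : k) :
    (chartConst k i a).val = toCoordLoc k i (C a) := by
  change Localization.mk _ 1 = _
  rw [Localization.mk_one_eq_algebraMap]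
  rfl

/-- The division-free form of `x_j / x_i`: identities between ratios follow from it by cancelling
the unit `x_i`. -/
lemma X_mul_val_ratio (i j : Fin (n + 1)) :
    toCoordLoc k i (X i) * (ratio k i j).val = toCoordLoc k i (X j) := by
  rw [ratio, HomogeneousLocalization.Away.val_mk, Localization.mk_eq_mk', mul_comm]
  convert IsLocalization.mk'_spec (CoordLoc k i) (X j) _ using 2
  simp

lemma ratio_self (i : Fin (n + 1)) : ratio k i i = 1 := by
  rw [HomogeneousLocalization.ext_iff_val, HomogeneousLocalization.val_one]
  refine (IsLocalization.Away.algebraMap_isUnit (S := CoordLoc k i)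
    (X i : MvPolynomial _ k)).mul_right_injective ?_
  exact (X_mul_val_ratio i i).trans (mul_one _).symm

/-- For `f` homogeneous of degree `d`, the fraction `f / x_i ^ d` is `f` evaluated at the ratios
`x_j / x_i`, so the constants and the ratios generate the chart ring. -/
lemma chartRing_surjective (i : Fin (n + 1)) :
    Function.Surjective (eval₂Hom (chartConst k i) (ratio k i)) := by
  intro z
  obtain ⟨d, f, hf, rfl⟩ := HomogeneousLocalization.Away.mk_surjective _ (X_mem k i) z
  refine ⟨f, ?_⟩
  rw [HomogeneousLocalization.ext_iff_val, HomogeneousLocalization.Away.val_mk,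
    ← HomogeneousLocalization.algebraMap_apply, ← RingHom.comp_apply]
  rw [Localization.mk_eq_mk', IsLocalization.eq_mk'_iff_mul_eq, mul_comm]
  have e : ((algebraMap (ChartRing k i) (CoordLoc k i)).comp
      (eval₂Hom (chartConst k i) (ratio k i))) f =
      f.eval₂ ((toCoordLoc k i).comp C)
        (fun j ↦ (ratio k i j).val) := by
    rw [RingHom.comp_apply, coe_eval₂Hom, hom_eval₂]
    congr 1
  have hf' : f.IsHomogeneous d := by simpa using hf
  rw [e, map_pow, ← eval₂_smul_of_isHomogeneous _ _ _ hf']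
  have : (fun j ↦ toCoordLoc k i (X i) *
      (ratio k i j).val) = fun j ↦ toCoordLoc k i (X j) :=
    funext fun j ↦ X_mul_val_ratio i j
  rw [this]
  change eval₂Hom _ _ f = algebraMap _ _ f
  congr 1
  ext <;> simp

lemma chartRing_hom_ext {i : Fin (n + 1)} {g₁ g₂ : ChartRing k i →+* R}
    (hc : g₁.comp (chartConst k i) = g₂.comp (chartConst k i))
    (hr : ∀ j, g₁ (ratio k i j) = g₂ (ratio k i j)) : g₁ = g₂ := by
  rw [← RingHom.cancel_right (chartRing_surjective i)]
  ext j
  · simpa using congr($hc j)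
  · simpa using hr j

/-- Evaluation of functions on the chart `x_i ≠ 0` at the point `[v]`. -/
def chartEval (c : k →+* R) (v : Fin (n + 1) → R) (i : Fin (n + 1)) (hu : IsUnit (v i)) :
    ChartRing k i →+* R :=
  (IsLocalization.Away.lift (S := CoordLoc k i) (X i) (g := eval₂Hom c v)
    (by simpa using hu)).comp (algebraMap _ _)

lemma chartEval_const (c : k →+* R) (v : Fin (n + 1) → R) (i : Fin (n + 1)) (hu : IsUnit (v i)) :
    (chartEval c v i hu).comp (chartConst k i) = c := by
  ext a
  simp [chartEval, val_chartConst]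

lemma mul_chartEval_ratio (c : k →+* R) (v : Fin (n + 1) → R) (i j : Fin (n + 1))
    (hu : IsUnit (v i)) : v i * chartEval c v i hu (ratio k i j) = v j := by
  have := congr(IsLocalization.Away.lift (S := CoordLoc k i) (X i)
    (g := eval₂Hom c v) (by simpa using hu) $(X_mul_val_ratio (k := k) i j))
  rw [map_mul, IsLocalization.Away.lift_eq, IsLocalization.Away.lift_eq] at this
  simpa [chartEval] using this

lemma comp_chartEval {R' : Type u} [CommRing R'] (g : R →+* R') (c : k →+* R)
    (v : Fin (n + 1) → R) (i : Fin (n + 1)) (hu : IsUnit (v i)) :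
    g.comp (chartEval c v i hu) = chartEval (g.comp c) (fun j ↦ g (v j)) i (hu.map g) := by
  refine chartRing_hom_ext ?_ fun j ↦ ?_
  · rw [RingHom.comp_assoc, chartEval_const, chartEval_const]
  · refine (hu.map g).mul_right_injective ?_
    have := mul_chartEval_ratio (g.comp c) (fun j ↦ g (v j)) i j (hu.map g)
    simp only [RingHom.comp_apply] at this ⊢
    rw [this, ← map_mul, mul_chartEval_ratio]

/-- Evaluation on the chart only sees the quotients `v_j / v_i`; cross-multiplication expresses
their equality over any ring. -/
lemma chartEval_eq_iff {c : k →+* R} {v w : Fin (n + 1) → R} {i : Fin (n + 1)}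
    {hv : IsUnit (v i)} {hw : IsUnit (w i)} :
    chartEval c v i hv = chartEval c w i hw ↔ ∀ j, v i * w j = w i * v j := by
  constructor
  · intro h j
    rw [← mul_chartEval_ratio c w i j hw, ← mul_chartEval_ratio c v i j hv, h]
    ring
  · intro h
    refine chartRing_hom_ext (by rw [chartEval_const, chartEval_const]) fun j ↦ ?_
    refine (hv.mul hw).mul_right_injective ?_
    have h1 := mul_chartEval_ratio c v i j hv
    have h2 := mul_chartEval_ratio c w i j hw
    dsimp only
    linear_combination w i * h1 - v i * h2 - h j

/-- The coordinate ring of the chart `x_i ≠ 0` is a polynomial ring. -/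
lemma chartEval_insertNth_bijective (i : Fin (n + 1)) :
    Function.Bijective (chartEval (k := k) C (i.insertNth 1 X : Fin (n + 1) → MvPolynomial (Fin n) k)
      i (by simp)) := by
  set E := chartEval (k := k) C (i.insertNth 1 X : Fin (n + 1) → MvPolynomial (Fin n) k)
    i (by simp)
  let g : MvPolynomial (Fin n) k →+* ChartRing k i :=
    eval₂Hom (chartConst k i) fun j ↦ ratio k i (i.succAbove j)
  have hE : ∀ j, E (ratio k i j) = (i.insertNth 1 X : Fin (n + 1) → MvPolynomial (Fin n) k) j := by
    intro j
    have h : (i.insertNth 1 X : Fin (n + 1) → MvPolynomial (Fin n) k) i * E (ratio k i j) = _ :=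
      mul_chartEval_ratio (k := k) C _ i j _
    rwa [Fin.insertNth_apply_same, one_mul] at h
  have h1 : E.comp g = RingHom.id _ := by
    ext j
    · have := congr($(chartEval_const (k := k) C
        (i.insertNth 1 X : Fin (n + 1) → MvPolynomial (Fin n) k) i (by simp)) j)
      simp [g, ← this, E]
    · simp [g, hE]
  have h2 : g.comp E = RingHom.id _ := by
    refine chartRing_hom_ext ?_ fun j ↦ ?_
    · rw [RingHom.comp_assoc, chartEval_const]
      ext a
      simp [g]
    · rw [RingHom.comp_apply, hE]
      induction j using Fin.succAboveCases i with
      | x => simp [ratio_self]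
      | p j => simp [g]
  exact Function.bijective_iff_has_inverse.mpr
    ⟨g, fun x ↦ congr($h2 x), fun x ↦ congr($h1 x)⟩

end Away

/-! ### Points of `ℙⁿ` in homogeneous coordinates. -/

section Point

open MvPolynomial

variable {n : ℕ} {k : Type u} [Field k] {R : Type u} [CommRing R]

/-- The open immersion of the chart `x_i ≠ 0`. -/
def chartι (k : Type u) [Field k] (i : Fin (n + 1)) :
    Spec (.of (ChartRing k i)) ⟶ ProjSpace n k :=
  Proj.awayι (homogeneousSubmodule (Fin (n + 1)) k) (X i) (X_mem k i) one_pos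

instance (i : Fin (n + 1)) : IsOpenImmersion (chartι k i) :=
  inferInstanceAs (IsOpenImmersion (Proj.awayι _ _ _ _))

/-- A point with `v_i` invertible factors through the chart `x_i ≠ 0`. -/
lemma projPoint_eq (c : k →+* R) (v : Fin (n + 1) → R) (hv : Ideal.span (Set.range v) = ⊤)
    (i : Fin (n + 1)) (hu : IsUnit (v i)) :
    projPoint c v hv = Spec.map (CommRingCat.ofHom (chartEval c v i hu)) ≫ chartι k i := by
  have hX := X_mem k i
  let f := coordHom c v
  let e : ChartRing k i →+* Γ(Spec (.of R), ⊤) :=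
    (Scheme.ΓSpecIso (.of R)).inv.hom.comp (chartEval c v i hu)
  have hx : IsUnit (f (X i)) := by
    simpa [f, coordHom] using hu.map (Scheme.ΓSpecIso (.of R)).inv.hom
  have htop : (Spec (.of R)).basicOpen (f (X i)) = ⊤ := Scheme.basicOpen_of_isUnit _ hx
  have hι : IsIso ((Spec (.of R)).basicOpen (f (X i))).ι := by
    have : ∀ U : (Spec (.of R)).Opens, U = ⊤ → IsIso U.ι := by
      rintro _ rfl
      exact inferInstanceAs (IsIso (Scheme.topIso _).hom)
    exact this _ htop
  -- Since `v_i` is invertible, this basic open is all of `Spec R`, so the local description of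
  -- `Proj.fromOfGlobalSections` over it determines the whole morphism.
  rw [← cancel_epi ((Spec (.of R)).basicOpen (f (X i))).ι]
  have h1 := Proj.fromOfGlobalSections_resLE _ f (coordHom_irrelevant c v hv) one_pos hX
  have h2 := congr($h1 ≫ Scheme.Opens.ι _)
  rw [Scheme.Hom.resLE_comp_ι] at h2
  refine h2.trans ?_
  have h3 : (IsLocalization.map (Localization.Away (f (X i))) f (M := .powers (X i))
      (T := .powers (f (X i))) (by
        rw [← Submonoid.map_le_iff_le_comap, Submonoid.map_powers])).comp
        (algebraMap (ChartRing k i) (CoordLoc k i)) = (algebraMap _ _).comp e := by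
    refine chartRing_hom_ext ?_ fun j ↦ ?_
    · ext a
      have hc := congr($(chartEval_const c v i hu) a)
      simp only [RingHom.comp_apply] at hc
      simp only [RingHom.comp_apply, HomogeneousLocalization.algebraMap_apply, val_chartConst,
        IsLocalization.map_eq, e, hc]
      simp [f, coordHom]
    · have hr : f (X i) * e (ratio k i j) = f (X j) := by
        have h := congr((Scheme.ΓSpecIso (.of R)).inv.hom $(mul_chartEval_ratio c v i j hu))
        rw [map_mul] at h
        simpa [f, coordHom, e] using h
      refine (IsLocalization.Away.algebraMap_isUnit (S := Localization.Away (f (X i)))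
        (f (X i))).mul_right_injective ?_
      dsimp only [RingHom.comp_apply]
      rw [← map_mul, hr, ← IsLocalization.map_eq (M := .powers (X i)) (S := CoordLoc k i)
        (g := f) (T := .powers (f (X i))) (by
        rw [← Submonoid.map_le_iff_le_comap, Submonoid.map_powers]), ← map_mul,
        HomogeneousLocalization.algebraMap_apply, X_mul_val_ratio, IsLocalization.map_eq]
  simp only [Proj.toBasicOpenOfGlobalSections, Category.assoc, Proj.basicOpenIsoSpec_inv_ι]
  rw [h3, CommRingCat.ofHom_comp, Spec.map_comp, Category.assoc]
  have h5 : Spec.map (CommRingCat.ofHom e) =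
      Spec.map (Scheme.ΓSpecIso (.of R)).inv ≫ Spec.map (CommRingCat.ofHom (chartEval c v i hu)) := by
    rw [← Spec.map_comp]
    rfl
  rw [basicOpenIsoSpecAway_hom_SpecMap_assoc]
  refine (congrArg (_ ≫ ·) (morphismRestrict_ι_assoc (Spec (.of R)).toSpecΓ
    (PrimeSpectrum.basicOpen (f (X i))) _)).trans ?_
  rw [h5, Category.assoc, toSpecΓ_SpecMap_ΓSpecIso_inv_assoc]
  exact Scheme.isoOfEq_inv_ι_assoc _ _ _

lemma chartι_str (i : Fin (n + 1)) :
    chartι k i ≫ ProjSpace.str n k = Spec.map (CommRingCat.ofHom (chartConst k i)) := by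
  have := Proj.awayι_toSpecZero (homogeneousSubmodule (Fin (n + 1)) k) (X i) (X_mem k i) one_pos
  have h2 := congr($this ≫ Spec.map (CommRingCat.ofHom
      (algebraMap k (homogeneousSubmodule (Fin (n + 1)) k 0))))
  rw [Category.assoc, ← Spec.map_comp, ← CommRingCat.ofHom_comp] at h2
  exact h2

lemma exists_isUnit {L : Type*} [Field L] {v : Fin (n + 1) → L}
    (hv : Ideal.span (Set.range v) = ⊤) : ∃ i, IsUnit (v i) := by
  by_contra! h
  have : Set.range v ⊆ ({0} : Set L) := by
    rintro _ ⟨i, rfl⟩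
    simpa using h i
  rw [Ideal.span_eq_bot.mpr this] at hv
  exact bot_ne_top hv

lemma span_eq_top_of_isUnit {v : Fin (n + 1) → R} {i : Fin (n + 1)} (h : IsUnit (v i)) :
    Ideal.span (Set.range v) = ⊤ :=
  Ideal.eq_top_of_isUnit_mem _ (Ideal.subset_span ⟨i, rfl⟩) h

lemma projPoint_str (c : k →+* R) (v : Fin (n + 1) → R) (hv : Ideal.span (Set.range v) = ⊤)
    {i : Fin (n + 1)} (hu : IsUnit (v i)) :
    projPoint c v hv ≫ ProjSpace.str n k = Spec.map (CommRingCat.ofHom c) := by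
  rw [projPoint_eq c v hv i hu, Category.assoc, chartι_str, ← Spec.map_comp,
    ← CommRingCat.ofHom_comp, chartEval_const]

lemma specMap_projPoint {R' : Type u} [CommRing R'] (g : R →+* R') (c : k →+* R)
    (v : Fin (n + 1) → R) (hv : Ideal.span (Set.range v) = ⊤) {i : Fin (n + 1)}
    (hu : IsUnit (v i)) :
    Spec.map (CommRingCat.ofHom g) ≫ projPoint c v hv =
      projPoint (g.comp c) (fun j ↦ g (v j)) (span_eq_top_of_isUnit (hu.map g)) := by
  rw [projPoint_eq c v hv i hu, projPoint_eq (g.comp c) _ _ i (hu.map g), ← comp_chartEval,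
    CommRingCat.ofHom_comp, Spec.map_comp, Category.assoc]

lemma chartι_opensRange (i : Fin (n + 1)) : (chartι k i).opensRange =
    Proj.basicOpen (homogeneousSubmodule (Fin (n + 1)) k) (X i) :=
  Proj.opensRange_awayι _ _ _ _

/-- A field-valued point in the chart `x_i ≠ 0` has nonzero `i`-th coordinate. -/
lemma isUnit_of_mem_chart {L : Type u} [Field L] (c : k →+* L) (v : Fin (n + 1) → L)
    (hv : Ideal.span (Set.range v) = ⊤) (i : Fin (n + 1)) {x : Spec (.of L)}
    (h : projPoint c v hv x ∈ Set.range (chartι k i)) : IsUnit (v i) := by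
  have h' : x ∈ projPoint c v hv ⁻¹ᵁ
      Proj.basicOpen (homogeneousSubmodule (Fin (n + 1)) k) (X i) := by
    rw [← chartι_opensRange]; exact h
  have e := Proj.fromOfGlobalSections_preimage_basicOpen _ (coordHom c v)
    (coordHom_irrelevant c v hv) one_pos (X_mem k i)
  have h2 := e.le h'
  rw [isUnit_iff_ne_zero]
  intro h0
  have h3 : coordHom c v (X i) = 0 := by simp [coordHom, h0]
  rw [h3, Scheme.basicOpen_zero] at h2
  exact h2

/-- Passes from an equality of morphisms back to an equality of evaluations: the chart is a
monomorphism, and lying in it forces `v_i ≠ 0`. -/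
lemma projPoint_eq_comp_chartι {L : Type u} [Field L] {c : k →+* L} {v : Fin (n + 1) → L}
    {hv : Ideal.span (Set.range v) = ⊤} {i : Fin (n + 1)} {g : ChartRing k i →+* L}
    (h : projPoint c v hv = Spec.map (CommRingCat.ofHom g) ≫ chartι k i) :
    ∃ hu : IsUnit (v i), g = chartEval c v i hu := by
  have hu : IsUnit (v i) := by
    refine isUnit_of_mem_chart c v hv i (x := default) ?_
    rw [h]
    exact ⟨_, rfl⟩
  refine ⟨hu, ?_⟩
  rw [projPoint_eq c v hv i hu, cancel_mono] at h
  exact (congr(($(Spec.map_injective h)).hom)).symm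

/-- Two vectors over a field define the same point iff they are proportional. -/
lemma projPoint_eq_iff {L : Type u} [Field L] {c : k →+* L} {v w : Fin (n + 1) → L}
    {hv : Ideal.span (Set.range v) = ⊤} {hw : Ideal.span (Set.range w) = ⊤} :
    projPoint c v hv = projPoint c w hw ↔ ∃ a : L, a ≠ 0 ∧ ∀ j, w j = a * v j := by
  obtain ⟨i, hi⟩ := exists_isUnit hv
  constructor
  · intro h
    rw [projPoint_eq c v hv i hi] at h
    obtain ⟨hu, h'⟩ := projPoint_eq_comp_chartι h.symm
    rw [chartEval_eq_iff] at h'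
    refine ⟨w i / v i, div_ne_zero hu.ne_zero hi.ne_zero, fun j ↦ ?_⟩
    have := h' j
    field_simp [hi.ne_zero]
    linear_combination this
  · rintro ⟨a, ha, h⟩
    have hu : IsUnit (w i) := by
      rw [h]; exact ha.isUnit.mul hi
    rw [projPoint_eq c v hv i hi, projPoint_eq c w hw i hu, chartEval_eq_iff.mpr]
    intro j
    rw [h, h]
    ring

lemma iSup_chartι_opensRange : ⨆ i, (chartι (n := n) k i).opensRange = ⊤ := by
  simp_rw [chartι_opensRange]
  refine Proj.iSup_basicOpen_eq_top' _ _ (fun i ↦ ⟨1, X_mem k i⟩) ?_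
  rw [eq_top_iff]
  rintro p -
  induction p using MvPolynomial.induction_on with
  | C a =>
    exact Subalgebra.algebraMap_mem (Algebra.adjoin (homogeneousSubmodule (Fin (n + 1)) k 0) _)
      (algebraMap k (homogeneousSubmodule (Fin (n + 1)) k 0) a)
  | add p q hp hq => exact add_mem hp hq
  | mul_X p i hp => exact mul_mem hp (Algebra.subset_adjoin ⟨i, rfl⟩)

instance : IsSeparated (ProjSpace.str n k) :=
  inferInstanceAs (IsSeparated (Proj.toSpecZero _ ≫ Spec.map _))

instance : Algebra.FiniteType (homogeneousSubmodule (Fin (n + 1)) k 0)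
    (MvPolynomial (Fin (n + 1)) k) :=
  have : IsScalarTower k (homogeneousSubmodule (Fin (n + 1)) k 0) (MvPolynomial (Fin (n + 1)) k) :=
    ⟨fun a b c ↦ smul_mul_assoc a (b : MvPolynomial (Fin (n + 1)) k) c⟩
  .of_restrictScalars_finiteType k _ _

/-- Homogeneous polynomials of degree zero are constants, so `k` surjects onto the degree-zero part.
Finite type makes `ℙⁿ` over a field locally noetherian, which `support_graph` requires. -/
instance : LocallyOfFiniteType (ProjSpace.str n k) := by
  have : LocallyOfFiniteType (Spec.map (CommRingCat.ofHom
      (algebraMap k (homogeneousSubmodule (Fin (n + 1)) k 0)))) := by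
    rw [HasRingHomProperty.Spec_iff (P := @LocallyOfFiniteType)]
    refine RingHom.FiniteType.of_surjective _ ?_
    rintro ⟨p, hp⟩
    refine ⟨p.coeff 0, Subtype.ext ?_⟩
    have := (totalDegree_eq_zero_iff_eq_C).mp
      (Nat.le_zero.mp (IsHomogeneous.totalDegree_le hp))
    exact this.symm
  exact inferInstanceAs (LocallyOfFiniteType (Proj.toSpecZero _ ≫ Spec.map _))

end Point

/-! ### Charts and irreducibility of `Spec R × ℙⁿ`. -/

section Charts

open MvPolynomial

variable {n : ℕ} {k : Type u} [Field k] {R : CommRingCat.{u}}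

/-- The homogeneous coordinates on the chart `x_i = 1`. -/
def chartVec (n : ℕ) (R : Type u) [CommRing R] (i : Fin (n + 1)) :
    Fin (n + 1) → MvPolynomial (Fin n) R :=
  i.insertNth 1 X

lemma isUnit_chartVec (R : Type u) [CommRing R] (i : Fin (n + 1)) :
    IsUnit (chartVec n R i i) := by
  simp [chartVec]

lemma span_chartVec (R : Type u) [CommRing R] (i : Fin (n + 1)) :
    Ideal.span (Set.range (chartVec n R i)) = ⊤ :=
  span_eq_top_of_isUnit (isUnit_chartVec R i)

/-- The ring homomorphism `k → R` that defines the structure of a scheme over `k` on `Spec R`. -/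
abbrev baseHom (s : Spec R ⟶ Spec (.of k)) : k →+* R := (Spec.preimage s).hom

lemma specMap_baseHom (s : Spec R ⟶ Spec (.of k)) :
    Spec.map (CommRingCat.ofHom (baseHom s)) = s :=
  Spec.map_preimage s

/-- The chart `x_i ≠ 0` of `Spec R × ℙⁿ`. -/
def affineChart (n : ℕ) (s : Spec R ⟶ Spec (.of k)) (i : Fin (n + 1)) :
    Spec (.of (MvPolynomial (Fin n) R)) ⟶ pullback s (ProjSpace.str n k) :=
  pullback.lift (Spec.map (CommRingCat.ofHom C))
    (projPoint (C.comp (baseHom s)) (chartVec n R i) (span_chartVec R i)) (by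
      rw [projPoint_str _ _ _ (isUnit_chartVec R i), CommRingCat.ofHom_comp, Spec.map_comp]
      congr 1
      exact (specMap_baseHom s).symm)

lemma affineChart_fst (s : Spec R ⟶ Spec (.of k)) (i : Fin (n + 1)) :
    affineChart n s i ≫ pullback.fst s (ProjSpace.str n k) = Spec.map (CommRingCat.ofHom C) :=
  pullback.lift_fst _ _ _

lemma affineChart_snd (s : Spec R ⟶ Spec (.of k)) (i : Fin (n + 1)) :
    affineChart n s i ≫ pullback.snd s (ProjSpace.str n k) =
      projPoint (C.comp (baseHom s)) (chartVec n R i) (span_chartVec R i) :=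
  pullback.lift_snd _ _ _

lemma projPoint_chartVec (i : Fin (n + 1)) :
    ∃ e : Spec (.of (MvPolynomial (Fin n) k)) ≅ Spec (.of (ChartRing k i)),
      projPoint C (chartVec n k i) (span_chartVec k i) = e.hom ≫ chartι k i := by
  let r := RingEquiv.ofBijective _ (chartEval_insertNth_bijective (k := k) i)
  refine ⟨Scheme.Spec.mapIso r.toCommRingCatIso.op, ?_⟩
  rw [projPoint_eq C _ _ i (isUnit_chartVec k i)]
  rfl

attribute [local instance] algebraMvPolynomial in
lemma isPullback_specMap_C {R S : Type u} [CommRing R] [CommRing S] (c : R →+* S) :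
    IsPullback (Spec.map (CommRingCat.ofHom (C : S →+* MvPolynomial (Fin n) S)))
      (Spec.map (CommRingCat.ofHom (MvPolynomial.map c))) (Spec.map (CommRingCat.ofHom c))
      (Spec.map (CommRingCat.ofHom (C : R →+* MvPolynomial (Fin n) R))) := by
  algebraize [c]
  refine isPullback_SpecMap_of_isPushout _ _ _ _ (IsPushout.flip ?_)
  exact (CommRingCat.isPushout_iff_isPushout (R := R) (S := S) (R' := MvPolynomial (Fin n) R)
    (S' := MvPolynomial (Fin n) S)).mpr inferInstance

/-- The chart over `R` is the base change of the chart over `k`; hence it is an open immersion, and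
its range is the preimage of the chart of `ℙⁿ`. -/
lemma affineChart_isPullback (s : Spec R ⟶ Spec (.of k)) (i : Fin (n + 1)) :
    IsPullback (affineChart n s i) (Spec.map (CommRingCat.ofHom (MvPolynomial.map (baseHom s))))
      (pullback.snd s (ProjSpace.str n k))
      (projPoint C (chartVec n k i) (span_chartVec k i)) := by
  refine IsPullback.of_right (h₁₂ := pullback.fst s (ProjSpace.str n k)) (h₂₂ := ProjSpace.str n k)
    (v₁₃ := s) ?_ ?_ (IsPullback.of_hasPullback s (ProjSpace.str n k))
  · rw [affineChart_fst, projPoint_str _ _ _ (isUnit_chartVec k i)]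
    have := isPullback_specMap_C (n := n) (baseHom s)
    rwa [specMap_baseHom] at this
  · rw [affineChart_snd, specMap_projPoint _ _ _ _ (isUnit_chartVec k i)]
    have e1 : (MvPolynomial.map (σ := Fin n) (baseHom s)).comp C = C.comp (baseHom s) := by
      ext; simp
    have e2 : (fun j ↦ MvPolynomial.map (baseHom s) (chartVec n k i j)) = chartVec n R i := by
      ext1 j
      induction j using Fin.succAboveCases i with
      | x => simp [chartVec]
      | p j => simp [chartVec]
    simp only [e1, e2]

instance (s : Spec R ⟶ Spec (.of k)) (i : Fin (n + 1)) : IsOpenImmersion (affineChart n s i) := by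
  refine MorphismProperty.of_isPullback (affineChart_isPullback s i).flip ?_
  obtain ⟨e, he⟩ := projPoint_chartVec (n := n) (k := k) i
  rw [he]
  infer_instance

lemma range_iso_hom_comp {X Y Z : Scheme.{u}} (e : X ≅ Y) (f : Y ⟶ Z) :
    Set.range (e.hom ≫ f) = Set.range f := by
  ext z
  constructor
  · rintro ⟨x, rfl⟩
    exact ⟨e.hom x, rfl⟩
  · rintro ⟨y, rfl⟩
    obtain ⟨x, rfl⟩ := e.hom.surjective y
    exact ⟨x, rfl⟩

lemma affineChart_opensRange (s : Spec R ⟶ Spec (.of k)) (i : Fin (n + 1)) :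
    (affineChart n s i).opensRange =
      pullback.snd s (ProjSpace.str n k) ⁻¹ᵁ (chartι k i).opensRange := by
  have h := affineChart_isPullback (n := n) s i
  obtain ⟨e, he⟩ := projPoint_chartVec (n := n) (k := k) i
  ext1
  change Set.range _ = _ ⁻¹' Set.range _
  rw [← h.isoPullback_hom_fst, range_iso_hom_comp, Scheme.Pullback.range_fst, he,
    range_iso_hom_comp]

lemma exists_mem_affineChart (s : Spec R ⟶ Spec (.of k)) (x : ↥(pullback s (ProjSpace.str n k))) :
    ∃ i, x ∈ (affineChart n s i).opensRange := by
  simp_rw [affineChart_opensRange]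
  have : pullback.snd s (ProjSpace.str n k) x ∈ ⨆ i, (chartι (n := n) k i).opensRange := by
    rw [iSup_chartι_opensRange]; trivial
  exact (TopologicalSpace.Opens.mem_iSup (α := ↥(ProjSpace n k))).mp this

/-- Each chart is an affine space over a domain, hence irreducible, and all charts contain the
section `[1 : ⋯ : 1]`; so nonempty opens from different charts still meet. -/
instance irreducibleSpace_prod [IsDomain R] (s : Spec R ⟶ Spec (.of k)) :
    IrreducibleSpace ↥(pullback s (ProjSpace.str n k)) := by
  let P := pullback s (ProjSpace.str n k)
  let p : Spec R ⟶ P := pullback.lift (𝟙 _) (projPoint (baseHom s) (fun _ ↦ 1)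
    (span_eq_top_of_isUnit (i := 0) isUnit_one)) (by
      rw [projPoint_str _ _ _ (i := 0) isUnit_one, specMap_baseHom, Category.id_comp])
  let y₀ : ↥(Spec R) := Nonempty.some inferInstance
  let x₀ : P := p y₀
  have hx₀ : ∀ i, x₀ ∈ (affineChart n s i).opensRange := by
    intro i
    rw [affineChart_opensRange]
    change (p ≫ pullback.snd s (ProjSpace.str n k)) y₀ ∈ (chartι k i).opensRange
    rw [pullback.lift_snd, projPoint_eq _ _ _ i isUnit_one]
    exact ⟨_, rfl⟩
  have key : ∀ (i : Fin (n + 1)) (U V : P.Opens), (U ⊓ (affineChart n s i).opensRange : Set P).Nonempty →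
      (V ⊓ (affineChart n s i).opensRange : Set P).Nonempty → (U ⊓ V : Set P).Nonempty := by
    rintro i U V ⟨_, hU, ⟨y, rfl⟩⟩ ⟨_, hV, ⟨z, rfl⟩⟩
    have h := nonempty_preirreducible_inter (affineChart n s i ⁻¹ᵁ U).2
      (affineChart n s i ⁻¹ᵁ V).2 ⟨y, hU⟩ ⟨z, hV⟩
    obtain ⟨w, h1, h2⟩ := h
    exact ⟨_, h1, h2⟩
  have : Nonempty P := ⟨x₀⟩
  have : PreirreducibleSpace P := by
    constructor
    rintro U V hU hV ⟨x, -, hx⟩ ⟨y, -, hy⟩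
    obtain ⟨i, hi⟩ := exists_mem_affineChart s x
    obtain ⟨j, hj⟩ := exists_mem_affineChart s y
    obtain ⟨z, hz⟩ := key i ⟨U, hU⟩ (affineChart n s j).opensRange ⟨x, hx, hi⟩ ⟨x₀, hx₀ j, hx₀ i⟩
    obtain ⟨w, hw⟩ := key j ⟨U, hU⟩ ⟨V, hV⟩ ⟨z, hz.1, hz.2⟩ ⟨y, hy, hj⟩
    exact ⟨w, trivial, hw⟩
  exact ⟨‹_›⟩

end Charts

/-! ### Uniqueness of the degree. -/

section Degree

open MvPolynomial

/-- In a domain with unique factorization, `a ∣ b f_i` for all `i` implies `a ∣ b` if the `f_i`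
have no common factor. -/
lemma dvd_of_forall_dvd_mul {ι D : Type*} [Fintype ι] [CommRing D] [IsDomain D]
    [UniqueFactorizationMonoid D] {f : ι → D} (hf : ∀ h, (∀ i, h ∣ f i) → IsUnit h) {a b : D}
    (h : ∀ i, a ∣ b * f i) : a ∣ b := by
  classical
  let : NormalizedGCDMonoid D := Classical.arbitrary _
  have h1 : a ∣ Finset.univ.gcd fun i ↦ b * f i := Finset.dvd_gcd fun i _ ↦ h i
  have h2 : IsUnit (Finset.univ.gcd f) := hf _ fun i ↦ Finset.gcd_dvd (Finset.mem_univ i)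
  exact h2.dvd_mul_right.mp (h1.trans (Finset.gcd_mul_left' _ f b).dvd)

/-- Proportionality makes `F j` divide `F' j * F i` for all `i`, hence divide `F' j` as the `F i`
have no common factor; by symmetry the two divide each other. Total degrees of a nonzero coordinate
then agree. -/
lemma degree_eq_of_proportional {n : ℕ} {K : Type*} [Field K] {d d' : ℕ}
    {F F' : Fin (n + 1) → MvPolynomial (Fin (n + 1)) K}
    (hd : ∀ i, (F i).IsHomogeneous d) (hd' : ∀ i, (F' i).IsHomogeneous d')
    (hF : ∀ h, (∀ i, h ∣ F i) → IsUnit h) (hF' : ∀ h, (∀ i, h ∣ F' i) → IsUnit h)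
    (hFF' : ∀ i j, F i * F' j = F j * F' i) : d = d' := by
  have hdvd : ∀ j, F j ∣ F' j ∧ F' j ∣ F j := by
    intro j
    refine ⟨dvd_of_forall_dvd_mul hF fun i ↦ ⟨F' i, ?_⟩, dvd_of_forall_dvd_mul hF' fun i ↦ ⟨F i, ?_⟩⟩
    · rw [mul_comm, hFF']
    · rw [← hFF' i j, mul_comm]
  obtain ⟨j, hj⟩ : ∃ j, F j ≠ 0 := by
    by_contra! h0
    exact not_isUnit_zero (hF 0 fun i ↦ by rw [h0])
  have hj' : F' j ≠ 0 := fun h ↦ hj (zero_dvd_iff.mp (h ▸ (hdvd j).2))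
  rw [← (hd j).totalDegree hj, ← (hd' j).totalDegree hj']
  exact le_antisymm (totalDegree_le_of_dvd_of_isDomain (hdvd j).1 hj')
    (totalDegree_le_of_dvd_of_isDomain (hdvd j).2 hj)

/-- A homogeneous polynomial is determined by its restriction to the chart `x_i = 1`. -/
lemma eq_zero_of_eval₂_chartVec {n : ℕ} {K : Type u} [Field K] (i : Fin (n + 1)) {d : ℕ}
    {G : MvPolynomial (Fin (n + 1)) K} (hG : G.IsHomogeneous d)
    (h : G.eval₂ C (chartVec n K i) = 0) : G = 0 := by
  let M := FractionRing (MvPolynomial (Fin (n + 1)) K)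
  let a : MvPolynomial (Fin (n + 1)) K →+* M := algebraMap _ _
  have hXi : a (X i) ≠ 0 := by
    simp [a]
  -- Substituting `x_j / x_i` and multiplying by `x_i ^ d` undoes the dehomogenization of a form of
  -- degree `d`.
  let ψ : MvPolynomial (Fin n) K →+* M :=
    eval₂Hom (a.comp C) fun j ↦ a (X (i.succAbove j)) / a (X i)
  have h1 := congr(ψ $h)
  rw [map_zero, hom_eval₂] at h1
  change eval₂ _ (ψ ∘ chartVec n K i) G = 0 at h1
  have h2 : ψ.comp C = a.comp C := by ext; simp [ψ]
  have h3 : (fun j ↦ a (X i) * (ψ ∘ chartVec n K i) j) = fun j ↦ a (X j) := by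
    ext j
    induction j using Fin.succAboveCases i with
    | x => simp [chartVec]
    | p j =>
      simp only [Function.comp_apply, chartVec, Fin.insertNth_apply_succAbove, ψ, coe_eval₂Hom,
        eval₂_X]
      rw [mul_div_assoc', mul_div_cancel_left₀ _ hXi]
  have h4 := eval₂_smul_of_isHomogeneous (a.comp C) (a (X i)) (ψ ∘ chartVec n K i) hG
  rw [← h2, h1, mul_zero, h3, h2] at h4
  have h5 : a G = 0 := by
    rw [← h4]
    change a G = eval₂Hom (a.comp C) (fun j ↦ a (X j)) G
    congr 1
    ext <;> simp
  exact (map_eq_zero_iff a (IsFractionRing.injective _ _)).mp h5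

variable {n : ℕ} {k : Type u} [Field k]

section Generic

variable {K : CommRingCat.{u}} [IsDomain K] (s : Spec K ⟶ Spec (.of k))

variable (n K) in
/-- The function field of the affine space over a domain. -/
abbrev AffineFrac : Type u := FractionRing (MvPolynomial (Fin n) K)

variable (n) in
/-- The generic point of `Spec K × ℙⁿ`. -/
def genericPt : Spec (.of (AffineFrac n K)) ⟶ pullback s (ProjSpace.str n k) :=
  Spec.map (CommRingCat.ofHom (algebraMap (MvPolynomial (Fin n) K) (AffineFrac n K))) ≫
    affineChart n s 0

/-- By irreducibility `W` meets the chart `x_0 ≠ 0`, and the one-point spectrum of the function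
field is dense there. -/
lemma range_genericPt_subset (W : (pullback s (ProjSpace.str n k)).Opens)
    (hW : (W : Set ↥(pullback s (ProjSpace.str n k))).Nonempty) :
    Set.range (genericPt n s) ⊆ Set.range W.ι := by
  have hne : (W ⊓ (affineChart n s 0).opensRange : Set ↥(pullback s (ProjSpace.str n k))).Nonempty := by
    refine nonempty_preirreducible_inter W.2 (affineChart n s 0).opensRange.2 hW ?_
    exact ⟨_, (Nonempty.some inferInstance : ↥(Spec (.of (MvPolynomial (Fin n) K)))), rfl⟩
  obtain ⟨_, hy, ⟨y, rfl⟩⟩ := hne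
  have hd : DenseRange (PrimeSpectrum.comap (algebraMap (MvPolynomial (Fin n) K) (AffineFrac n K))) := by
    rw [PrimeSpectrum.denseRange_comap_iff_ker_le_nilRadical,
      (RingHom.injective_iff_ker_eq_bot _).mp (IsFractionRing.injective _ _)]
    exact bot_le
  obtain ⟨z, hz⟩ := hd.exists_mem_open (affineChart n s 0 ⁻¹ᵁ W).2 ⟨y, hy⟩
  rintro _ ⟨z', rfl⟩
  obtain rfl : z = z' := Subsingleton.elim (α := PrimeSpectrum (AffineFrac n K)) _ _
  rw [Scheme.Opens.range_ι]
  exact hz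

lemma nonempty_of_surjective {W : (pullback s (ProjSpace.str n k)).Opens}
    (h : Surjective (W.ι ≫ pullback.fst s (ProjSpace.str n k))) :
    (W : Set ↥(pullback s (ProjSpace.str n k))).Nonempty := by
  obtain ⟨y, -⟩ := h.surj (Nonempty.some inferInstance : ↥(Spec K))
  exact ⟨y.1, y.2⟩

/-- The lift of the generic point to an open subscheme that meets all fibres. -/
def genericLift (W : (pullback s (ProjSpace.str n k)).Opens)
    (h : Surjective (W.ι ≫ pullback.fst s (ProjSpace.str n k))) :
    Spec (.of (AffineFrac n K)) ⟶ W.toScheme :=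
  IsOpenImmersion.lift W.ι (genericPt n s)
    (range_genericPt_subset s W (nonempty_of_surjective s h))

lemma genericLift_ι (W : (pullback s (ProjSpace.str n k)).Opens)
    (h : Surjective (W.ι ≫ pullback.fst s (ProjSpace.str n k))) :
    genericLift s W h ≫ W.ι = genericPt n s :=
  IsOpenImmersion.lift_fac _ _ _

/-- Related representatives agree on an open set that contains the generic point, so the value there
depends only on the class. This makes polynomials attached to different representatives comparable.
-/
lemma genericLift_hom_eq_of_mk_eq {φ ψ : BirRep (ProjSpace.str n k) s} (h : Bir.mk φ = Bir.mk ψ) :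
    genericLift s φ.source φ.surj_source ≫ φ.hom =
      genericLift s ψ.source ψ.surj_source ≫ ψ.hom := by
  let T : Bir (ProjSpace.str n k) s →
      (Spec (.of (AffineFrac n K)) ⟶ pullback s (ProjSpace.str n k)) :=
    Quot.lift (fun φ ↦ genericLift s φ.source φ.surj_source ≫ φ.hom) (by
      rintro φ ψ ⟨W, h₁, h₂, hs, e⟩
      have key : ∀ (θ : BirRep (ProjSpace.str n k) s) (hW : W ≤ θ.source),
          genericLift s θ.source θ.surj_source =
            genericLift s W hs ≫ (pullback s (ProjSpace.str n k)).homOfLE hW := by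
        intro θ hW
        rw [← cancel_mono θ.source.ι, genericLift_ι, Category.assoc, Scheme.homOfLE_ι,
          genericLift_ι]
      rw [key φ h₁, key ψ h₂, Category.assoc, Category.assoc, e])
  exact congrArg T h

end Generic

/-- The degree of a birational transformation over a field is well defined. -/
lemma HasDegree.unique {K : CommRingCat.{u}} (hK : IsField K) {s : Spec K ⟶ Spec (.of k)}
    {f : Bir (ProjSpace.str n k) s} {d d' : ℕ} (h : HasDegree f d) (h' : HasDegree f d') :
    d = d' := by
  let := hK.toField
  obtain ⟨F, hd, hF, φ, hφ, hφF⟩ := h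
  obtain ⟨F', hd', hF', φ', hφ', hφF'⟩ := h'
  let a : MvPolynomial (Fin n) K →+* AffineFrac n K := algebraMap _ _
  let e : K →+* AffineFrac n K := a.comp C
  -- Coordinates of the generic point: a nonzero form does not vanish at them, so both tuples of
  -- polynomials may be evaluated here.
  let v : Fin (n + 1) → AffineFrac n K := fun j ↦ a (chartVec n K 0 j)
  have hv0 : IsUnit (v 0) := (isUnit_chartVec K 0).map a
  have hv : Ideal.span (Set.range v) = ⊤ := span_eq_top_of_isUnit hv0
  have hinj : ∀ {m : ℕ} {G : MvPolynomial (Fin (n + 1)) K}, G.IsHomogeneous m →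
      G.eval₂ e v = 0 → G = 0 := by
    intro m G hG h0
    refine eq_zero_of_eval₂_chartVec 0 hG ?_
    rw [← map_eq_zero_iff a (IsFractionRing.injective _ _), hom_eval₂]
    exact h0
  have hspan : ∀ {m : ℕ} {G : Fin (n + 1) → MvPolynomial (Fin (n + 1)) K},
      (∀ i, (G i).IsHomogeneous m) → (∀ h, (∀ i, h ∣ G i) → IsUnit h) →
      Ideal.span (Set.range fun i ↦ (G i).eval₂ e v) = ⊤ := by
    intro m G hm hG
    obtain ⟨j, hj⟩ : ∃ j, G j ≠ 0 := by
      by_contra! h0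
      exact not_isUnit_zero (hG 0 fun i ↦ by rw [h0])
    exact span_eq_top_of_isUnit (i := j) (isUnit_iff_ne_zero.mpr fun h0 ↦ hj (hinj (hm j) h0))
  have hfst : genericPt n s ≫ pullback.fst s (ProjSpace.str n k) =
      Spec.map (CommRingCat.ofHom e) := by
    rw [genericPt, Category.assoc, affineChart_fst, ← Spec.map_comp]
    rfl
  have hsnd : genericPt n s ≫ pullback.snd s (ProjSpace.str n k) =
      projPoint (e.comp (baseHom s)) v hv := by
    rw [genericPt, Category.assoc, affineChart_snd, specMap_projPoint _ _ _ _ (isUnit_chartVec _ 0)]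
    rfl
  have e1 := hφF _ e v hv (hspan hd hF) (genericLift s φ.source φ.surj_source)
    (by rw [reassoc_of% genericLift_ι, hfst]) (by rw [reassoc_of% genericLift_ι, hsnd])
  have e2 := hφF' _ e v hv (hspan hd' hF') (genericLift s φ'.source φ'.surj_source)
    (by rw [reassoc_of% genericLift_ι, hfst]) (by rw [reassoc_of% genericLift_ι, hsnd])
  have e3 := congr($(genericLift_hom_eq_of_mk_eq s (hφ.trans hφ'.symm)) ≫
    pullback.snd s (ProjSpace.str n k))
  rw [Category.assoc, Category.assoc, e1, e2, projPoint_eq_iff] at e3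
  obtain ⟨b, -, hb⟩ := e3
  refine degree_eq_of_proportional hd hd' hF hF' fun i j ↦ ?_
  rw [← sub_eq_zero]
  refine hinj (((hd i).mul (hd' j)).sub ((hd j).mul (hd' i))) ?_
  rw [eval₂_sub, eval₂_mul, eval₂_mul, hb i, hb j]
  ring

end Degree

/-! ### Compatibility of base change with the original transformation. -/

section Pull

variable {X S A B : Scheme.{u}} {πX : X ⟶ S} {πA : A ⟶ S}

/-- The map from the domain of the base change to the domain of the transformation. -/
def pullSourceMap (φ : BirRep πX πA) (g : B ⟶ A) :
    (φ.pull g).source.toScheme ⟶ φ.source.toScheme :=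
  prodMap πX πA g ∣_ φ.source

lemma pullSourceMap_ι (φ : BirRep πX πA) (g : B ⟶ A) :
    pullSourceMap φ g ≫ φ.source.ι = (φ.pull g).source.ι ≫ prodMap πX πA g :=
  morphismRestrict_ι _ _

lemma pullSourceMap_hom (φ : BirRep πX πA) (g : B ⟶ A) :
    pullSourceMap φ g ≫ φ.hom = (φ.pull g).hom ≫ prodMap πX πA g := by
  rw [BirRep.pull_hom]
  exact (BirRep.pullHom_prodMap φ g).symm

end Pull

/-! ### Birational transformations given by automorphisms of affine space. -/

section AffineRep

open MvPolynomial

variable {n : ℕ} {k : Type u} [Field k] {R : CommRingCat.{u}} {s : Spec R ⟶ Spec (.of k)}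

/-- The representative `φ` is defined precisely on the affine space `Spec R[x_1, …, x_n]`, where it
is given by the endomorphism `τ` of the polynomial ring. -/
def IsAffineRep (φ : BirRep (ProjSpace.str n k) s)
    (τ : MvPolynomial (Fin n) R →+* MvPolynomial (Fin n) R) : Prop :=
  ∃ j : Spec (.of (MvPolynomial (Fin n) R)) ≅ φ.source.toScheme,
    j.hom ≫ φ.source.ι = affineChart n s 0 ∧
      j.hom ≫ φ.hom = Spec.map (CommRingCat.ofHom τ) ≫ affineChart n s 0

lemma surjective_affineChart_fst :
    Surjective ((affineChart n s 0).opensRange.ι ≫ pullback.fst s (ProjSpace.str n k)) := by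
  have h : (affineChart n s 0).isoOpensRange.hom ≫ (affineChart n s 0).opensRange.ι ≫
      pullback.fst s (ProjSpace.str n k) = Spec.map (CommRingCat.ofHom C) := by
    rw [Scheme.Hom.isoOpensRange_hom_ι_assoc, affineChart_fst]
  have hs : Surjective (Spec.map (CommRingCat.ofHom (C : R →+* MvPolynomial (Fin n) R))) := by
    constructor
    intro x
    -- The zero section provides a preimage of each point.
    refine ⟨Spec.map (CommRingCat.ofHom (eval (fun _ ↦ (0 : R)))) x, ?_⟩
    rw [← Scheme.Hom.comp_apply, ← Spec.map_comp, ← CommRingCat.ofHom_comp]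
    have : (eval (fun _ : Fin n ↦ (0 : R))).comp C = RingHom.id R := by ext; simp
    rw [this]
    simp
  rw [← h] at hs
  exact Surjective.of_comp (affineChart n s 0).isoOpensRange.hom _

variable (s) in
/-- The birational transformation given by an automorphism of the affine space. -/
def affineRep (σ : MvPolynomial (Fin n) R ≃+* MvPolynomial (Fin n) R)
    (hσ : ∀ r, σ (C r) = C r) : BirRep (ProjSpace.str n k) s where
  source := (affineChart n s 0).opensRange
  target := (affineChart n s 0).opensRange
  iso := (affineChart n s 0).isoOpensRange.symm ≪≫ Scheme.Spec.mapIso σ.toCommRingCatIso.op ≪≫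
    (affineChart n s 0).isoOpensRange
  isOver := by
    have h : Spec.map σ.toCommRingCatIso.hom ≫ Spec.map (CommRingCat.ofHom C) =
        Spec.map (CommRingCat.ofHom (C : R →+* MvPolynomial (Fin n) R)) := by
      rw [← Spec.map_comp]
      congr 1
      ext r : 2
      exact hσ r
    simp only [Iso.trans_hom, Iso.symm_hom, Category.assoc, Scheme.Hom.isoOpensRange_hom_ι_assoc,
      affineChart_fst]
    rw [Iso.inv_comp_eq, Scheme.Hom.isoOpensRange_hom_ι_assoc, affineChart_fst]
    exact h
  surj_source := surjective_affineChart_fst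
  surj_target := surjective_affineChart_fst

lemma isAffineRep_affineRep (σ : MvPolynomial (Fin n) R ≃+* MvPolynomial (Fin n) R)
    (hσ : ∀ r, σ (C r) = C r) : IsAffineRep (affineRep s σ hσ) σ.toRingHom := by
  refine ⟨(affineChart n s 0).isoOpensRange, Scheme.Hom.isoOpensRange_hom_ι _, ?_⟩
  simp only [affineRep, BirRep.hom, Iso.trans_hom, Iso.symm_hom, Category.assoc,
    Iso.hom_inv_id_assoc, Scheme.Hom.isoOpensRange_hom_ι]
  rfl

lemma isAffineRep_affineRep_inv (σ : MvPolynomial (Fin n) R ≃+* MvPolynomial (Fin n) R)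
    (hσ : ∀ r, σ (C r) = C r) : IsAffineRep (affineRep s σ hσ).inv σ.symm.toRingHom := by
  refine ⟨(affineChart n s 0).isoOpensRange, Scheme.Hom.isoOpensRange_hom_ι _, ?_⟩
  simp only [affineRep, BirRep.hom, BirRep.inv, Iso.trans_symm, Iso.trans_hom, Iso.symm_hom,
    Category.assoc, Iso.hom_inv_id_assoc, Iso.symm_symm_eq, Scheme.Hom.isoOpensRange_hom_ι]
  rfl

variable {B : Scheme.{u}}

/-- The domain of `φ` is affine space, so a point of the base-changed domain yields a point of
affine space, that is, a ring homomorphism `u`; applying the transformation replaces `u` by `u ∘ τ`.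
-/
lemma exists_coordinates {φ : BirRep (ProjSpace.str n k) s}
    {τ : MvPolynomial (Fin n) R →+* MvPolynomial (Fin n) R} (hφ : IsAffineRep φ τ)
    (hτ : ∀ r, τ (C r) = C r) (g : B ⟶ Spec R) {L : Type u} [CommRing L]
    (p : Spec (.of L) ⟶ (φ.pull g).source.toScheme) :
    ∃ u : MvPolynomial (Fin n) R →+* L,
      p ≫ (φ.pull g).source.ι ≫ pullback.fst (g ≫ s) (ProjSpace.str n k) ≫ g =
        Spec.map (CommRingCat.ofHom (u.comp C)) ∧
      p ≫ (φ.pull g).source.ι ≫ pullback.snd (g ≫ s) (ProjSpace.str n k) =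
        projPoint (u.comp (C.comp (baseHom s))) (fun j ↦ u (chartVec n R 0 j))
          (span_eq_top_of_isUnit ((isUnit_chartVec R 0).map u)) ∧
      p ≫ (φ.pull g).hom ≫ pullback.snd (g ≫ s) (ProjSpace.str n k) =
        projPoint (u.comp (C.comp (baseHom s))) (fun j ↦ u (τ (chartVec n R 0 j)))
          (span_eq_top_of_isUnit (((isUnit_chartVec R 0).map τ).map u)) := by
  obtain ⟨j, hj₁, hj₂⟩ := hφ
  let q : Spec (.of L) ⟶ Spec (.of (MvPolynomial (Fin n) R)) :=
    p ≫ pullSourceMap φ g ≫ j.inv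
  let u : MvPolynomial (Fin n) R →+* L := (Spec.preimage q).hom
  have hu : Spec.map (CommRingCat.ofHom u) = q := Spec.map_preimage q
  have h1 : p ≫ (φ.pull g).source.ι ≫ prodMap (ProjSpace.str n k) s g =
      Spec.map (CommRingCat.ofHom u) ≫ affineChart n s 0 := by
    simp only [hu, ← hj₁, q, Category.assoc, Iso.inv_hom_id_assoc, pullSourceMap_ι]
  have h2 : p ≫ (φ.pull g).hom ≫ prodMap (ProjSpace.str n k) s g =
      Spec.map (CommRingCat.ofHom u) ≫ Spec.map (CommRingCat.ofHom τ) ≫ affineChart n s 0 := by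
    simp only [hu, ← hj₂, q, Category.assoc, Iso.inv_hom_id_assoc, pullSourceMap_hom]
  refine ⟨u, ?_, ?_, ?_⟩
  · rw [← prodMap_fst, reassoc_of% h1, affineChart_fst, ← Spec.map_comp]
    rfl
  · rw [← prodMap_snd, reassoc_of% h1, affineChart_snd,
      specMap_projPoint _ _ _ _ (isUnit_chartVec R 0)]
  · rw [← prodMap_snd, reassoc_of% h2, affineChart_snd,
      specMap_projPoint _ _ _ _ (isUnit_chartVec R 0),
      specMap_projPoint _ _ _ _ ((isUnit_chartVec R 0).map τ)]
    have : τ.comp (C.comp (baseHom s)) = C.comp (baseHom s) := by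
      ext r
      simp [hτ]
    simp only [this]

variable {K : CommRingCat.{u}}

/-- Homogeneous polynomials that dehomogenize to `τ` describe `τ` on field-valued points. -/
lemma projPoint_eval₂_eq {τ : MvPolynomial (Fin n) R →+* MvPolynomial (Fin n) R}
    {g : Spec K ⟶ Spec R} {F : Fin (n + 1) → MvPolynomial (Fin (n + 1)) K} {d : ℕ}
    (hF : ∀ j, (F j).IsHomogeneous d)
    (hτF : ∀ j, (F j).eval₂ C (chartVec n K 0) =
      MvPolynomial.map (Spec.preimage g).hom (τ (chartVec n R 0 j)))
    {L : Type u} [Field L] {e : K →+* L} {u : MvPolynomial (Fin n) R →+* L}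
    (hu : Spec.map (CommRingCat.ofHom e) ≫ g = Spec.map (CommRingCat.ofHom (u.comp C)))
    {v : Fin (n + 1) → L} {c : k →+* L} {hv : Ideal.span (Set.range v) = ⊤}
    (huv : projPoint c v hv = projPoint (u.comp (C.comp (baseHom s)))
      (fun j ↦ u (chartVec n R 0 j)) (span_eq_top_of_isUnit ((isUnit_chartVec R 0).map u)))
    (hc : c = u.comp (C.comp (baseHom s)))
    {hFv : Ideal.span (Set.range fun j ↦ (F j).eval₂ e v) = ⊤}
    {hτ : Ideal.span (Set.range fun j ↦ u (τ (chartVec n R 0 j))) = ⊤} :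
    projPoint (u.comp (C.comp (baseHom s))) (fun j ↦ u (τ (chartVec n R 0 j))) hτ =
      projPoint c (fun j ↦ (F j).eval₂ e v) hFv := by
  subst hc
  obtain ⟨a, ha, hav⟩ := projPoint_eq_iff.mp huv.symm
  have hav' : v = fun j ↦ a * u (chartVec n R 0 j) := funext hav
  -- The given coordinates are `a` times the affine ones, so forms of degree `d` scale by `a ^ d`.
  refine projPoint_eq_iff.mpr ⟨a ^ d, pow_ne_zero _ ha, fun j ↦ ?_⟩
  rw [hav', eval₂_smul_of_isHomogeneous _ _ _ (hF j)]
  congr 1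
  have he : e.comp (Spec.preimage g).hom = u.comp C := by
    have h : Spec.map (CommRingCat.ofHom e) ≫ Spec.map (Spec.preimage g) =
        Spec.map (CommRingCat.ofHom (u.comp C)) := by
      rw [Spec.map_preimage, hu]
    rw [← Spec.map_comp] at h
    exact congr(($(Spec.map_injective h)).hom)
  let w : MvPolynomial (Fin n) K →+* L := eval₂Hom e fun i ↦ u (X i)
  have hw : w.comp (MvPolynomial.map (Spec.preimage g).hom) = u := by
    ext r
    · simpa [w] using congr($he r)
    · simp [w]
  have hw' : ∀ j, w (chartVec n K 0 j) = u (chartVec n R 0 j) := by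
    intro j
    induction j using Fin.succAboveCases 0 with
    | x => simp [chartVec]
    | p j => simp [chartVec, w]
  have h := congr(w $(hτF j))
  rw [hom_eval₂, ← RingHom.comp_apply, hw] at h
  rw [← h]
  have hwC : w.comp C = e := by ext; simp [w]
  rw [hwC]
  congr 1
  exact funext fun j ↦ (hw' j).symm

lemma baseHom_comp {g : Spec K ⟶ Spec R} {L : Type u} [CommRing L] {e : K →+* L}
    {u : MvPolynomial (Fin n) R →+* L}
    (hu : Spec.map (CommRingCat.ofHom e) ≫ g = Spec.map (CommRingCat.ofHom (u.comp C))) :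
    e.comp (baseHom (g ≫ s)) = u.comp (C.comp (baseHom s)) := by
  have h : Spec.map (CommRingCat.ofHom (e.comp (baseHom (g ≫ s)))) =
      Spec.map (CommRingCat.ofHom (u.comp (C.comp (baseHom s)))) := by
    rw [← RingHom.comp_assoc, CommRingCat.ofHom_comp, CommRingCat.ofHom_comp, Spec.map_comp,
      Spec.map_comp, specMap_baseHom, specMap_baseHom, ← hu, Category.assoc]
  exact congr(($(Spec.map_injective h)).hom)

lemma hasDegree_pull {φ : BirRep (ProjSpace.str n k) s}
    {τ : MvPolynomial (Fin n) R →+* MvPolynomial (Fin n) R} (hφ : IsAffineRep φ τ)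
    (hτ : ∀ r, τ (C r) = C r) {g : Spec K ⟶ Spec R}
    {F : Fin (n + 1) → MvPolynomial (Fin (n + 1)) K} {d : ℕ} (hF : ∀ j, (F j).IsHomogeneous d)
    (hF' : ∀ h, (∀ i, h ∣ F i) → IsUnit h)
    (hτF : ∀ j, (F j).eval₂ C (chartVec n K 0) =
      MvPolynomial.map (Spec.preimage g).hom (τ (chartVec n R 0 j))) :
    HasDegree ((Bir.mk φ).pull g) d := by
  refine ⟨F, hF, hF', φ.pull g, rfl, ?_⟩
  intro L _ e v hv hFv p hp₁ hp₂
  obtain ⟨u, hu₁, hu₂, hu₃⟩ := exists_coordinates hφ hτ g p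
  rw [reassoc_of% hp₁] at hu₁
  rw [hu₃]
  exact projPoint_eval₂_eq hF hτF hu₁ (hp₂.symm.trans hu₂) (baseHom_comp hu₁)

/-- The inverse transformation as a map between the domains. -/
def invSourceMap {X S A : Scheme.{u}} {πX : X ⟶ S} {πA : A ⟶ S} (θ : BirRep πX πA) :
    θ.inv.source.toScheme ⟶ θ.source.toScheme :=
  θ.iso.inv

lemma invSourceMap_ι {X S A : Scheme.{u}} {πX : X ⟶ S} {πA : A ⟶ S} (θ : BirRep πX πA) :
    invSourceMap θ ≫ θ.source.ι = θ.inv.hom :=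
  rfl

lemma invSourceMap_hom {X S A : Scheme.{u}} {πX : X ⟶ S} {πA : A ⟶ S} (θ : BirRep πX πA) :
    invSourceMap θ ≫ θ.hom = θ.inv.source.ι :=
  θ.iso.inv_hom_id_assoc _

/-- A point of the domain of the inverse is the image of a point with coordinates `u`, so its own
coordinates are `u ∘ τ`, and the inverse sends it to `u = (u ∘ τ) ∘ τ'`. Hence `projPoint_eval₂_eq`
applies to `u ∘ τ` and `τ'`, and no comparison of inversion with base change is needed. -/
lemma hasDegree_pull_inv {φ : BirRep (ProjSpace.str n k) s}
    {τ τ' : MvPolynomial (Fin n) R →+* MvPolynomial (Fin n) R} (hφ : IsAffineRep φ τ)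
    (hτ : ∀ r, τ (C r) = C r) (hττ' : τ.comp τ' = RingHom.id _) {g : Spec K ⟶ Spec R}
    {F : Fin (n + 1) → MvPolynomial (Fin (n + 1)) K} {d : ℕ} (hF : ∀ j, (F j).IsHomogeneous d)
    (hF' : ∀ h, (∀ i, h ∣ F i) → IsUnit h)
    (hτF : ∀ j, (F j).eval₂ C (chartVec n K 0) =
      MvPolynomial.map (Spec.preimage g).hom (τ' (chartVec n R 0 j))) :
    HasDegree ((Bir.mk φ).pull g).inv d := by
  replace hττ' : ∀ p, τ (τ' p) = p := fun p ↦ congr($hττ' p)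
  refine ⟨F, hF, hF', (φ.pull g).inv, rfl, ?_⟩
  intro L _ e v hv hFv p hp₁ hp₂
  rw [← invSourceMap_hom, Category.assoc] at hp₁ hp₂
  rw [← invSourceMap_ι, Category.assoc]
  obtain ⟨u, hu₁, hu₂, hu₃⟩ := exists_coordinates hφ hτ g (p ≫ invSourceMap (φ.pull g))
  simp only [Category.assoc] at hu₁ hu₂ hu₃
  rw [hu₂]
  rw [BirRep.hom_fst] at hp₁
  rw [reassoc_of% hp₁] at hu₁
  have hτC : τ.comp C = C := by ext r; simp [hτ]
  have hu₁' : Spec.map (CommRingCat.ofHom e) ≫ g =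
      Spec.map (CommRingCat.ofHom ((u.comp τ).comp C)) := by
    rw [hu₁, RingHom.comp_assoc, hτC]
  have hc : (u.comp τ).comp (C.comp (baseHom s)) = u.comp (C.comp (baseHom s)) := by
    rw [RingHom.comp_assoc, ← RingHom.comp_assoc _ _ τ, hτC]
  have h := projPoint_eval₂_eq (s := s) (u := u.comp τ) hF hτF hu₁'
    (c := e.comp (baseHom (g ≫ s))) (v := v) (hv := hv)
    (by rw [← hp₂, hu₃]; simp only [hc, RingHom.comp_apply]) (baseHom_comp hu₁') (hFv := hFv)
    (hτ := by
      simp only [RingHom.comp_apply, hττ']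
      exact span_eq_top_of_isUnit ((isUnit_chartVec R 0).map u))
  rw [← h]
  simp only [hc, RingHom.comp_apply, hττ']

end AffineRep

/-! ### The polynomials that define `ξ` and its inverse. -/

section Xi

open MvPolynomial

variable {n : ℕ}

section Homogeneous

variable {K : Type*} [Field K]

/-- A common factor divides a power of the prime `x_0`, so a nonunit one is divisible by `x_0`. Then
every coordinate would vanish on `x_0 = 0`, which the point `v` excludes. -/
lemma isUnit_of_forall_dvd {F : Fin (n + 1) → MvPolynomial (Fin (n + 1)) K} {m : ℕ}
    (h0 : F 0 = X 0 ^ m) {i : Fin (n + 1)} {v : Fin (n + 1) → K} (hv : v 0 = 0)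
    (hi : eval v (F i) ≠ 0) (h : MvPolynomial (Fin (n + 1)) K) (hF : ∀ i, h ∣ F i) : IsUnit h := by
  obtain ⟨l, -, hl⟩ := (dvd_prime_pow (X_prime (i := (0 : Fin (n + 1)))) m).mp (h0 ▸ hF 0)
  rcases Nat.eq_zero_or_pos l with rfl | hl'
  · rw [pow_zero] at hl
    exact hl.isUnit_iff.mpr isUnit_one
  · have h1 : X 0 ∣ F i := ((dvd_pow_self _ hl'.ne').trans hl.symm.dvd).trans (hF i)
    obtain ⟨q, hq⟩ := h1
    exact absurd (by rw [hq]; simp [hv]) hi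

/-- The homogeneous polynomials defining the transformation `ξ(t)`. -/
def xiHom (hn : 3 ≤ n) (t : K) : Fin (n + 1) → MvPolynomial (Fin (n + 1)) K :=
  Fin.cons (X 0 ^ 2) fun i ↦
    if i.val = 0 then X i.succ * X 0 + X (Fin.succ ⟨1, by omega⟩) ^ 2
    else if i.val = 1 then X i.succ * X 0 + C t * X (Fin.succ ⟨2, by omega⟩) ^ 2
    else X i.succ * X 0

/-- The homogeneous polynomials defining the inverse of `ξ(t)` for `t ≠ 0`. -/
def xiInvHom (hn : 3 ≤ n) (t : K) : Fin (n + 1) → MvPolynomial (Fin (n + 1)) K :=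
  Fin.cons (X 0 ^ 4) fun i ↦
    if i.val = 0 then X i.succ * X 0 ^ 3 -
      (X (Fin.succ ⟨1, by omega⟩) * X 0 - C t * X (Fin.succ ⟨2, by omega⟩) ^ 2) ^ 2
    else if i.val = 1 then (X i.succ * X 0 - C t * X (Fin.succ ⟨2, by omega⟩) ^ 2) * X 0 ^ 2
    else X i.succ * X 0 ^ 3

/-- The homogeneous polynomials defining the inverse of `ξ(0)`. -/
def xiInvHomZero (K : Type*) [Field K] (hn : 3 ≤ n) :
    Fin (n + 1) → MvPolynomial (Fin (n + 1)) K :=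
  Fin.cons (X 0 ^ 2) fun i ↦
    if i.val = 0 then X i.succ * X 0 - X (Fin.succ ⟨1, by omega⟩) ^ 2
    else X i.succ * X 0

lemma isHomogeneous_X_mul_X_pow (i j : Fin (n + 1)) (m : ℕ) :
    (X i * X j ^ m : MvPolynomial (Fin (n + 1)) K).IsHomogeneous (1 + m) :=
  (isHomogeneous_X K i).mul (isHomogeneous_X_pow j m)

lemma isHomogeneous_C_mul_X_pow' (t : K) (j : Fin (n + 1)) (m : ℕ) :
    (C t * X j ^ m : MvPolynomial (Fin (n + 1)) K).IsHomogeneous m := by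
  simpa using (isHomogeneous_C (Fin (n + 1)) t).mul (isHomogeneous_X_pow j m)

lemma isHomogeneous_X_mul_X (i j : Fin (n + 1)) :
    (X i * X j : MvPolynomial (Fin (n + 1)) K).IsHomogeneous 2 :=
  (isHomogeneous_X K i).mul (isHomogeneous_X K j)

lemma xiHom_isHomogeneous (hn : 3 ≤ n) (t : K) (j : Fin (n + 1)) :
    (xiHom hn t j).IsHomogeneous 2 := by
  induction j using Fin.cases with
  | zero => exact isHomogeneous_X_pow 0 2
  | succ i =>
    simp only [xiHom, Fin.cons_succ]
    split_ifs
    · exact (isHomogeneous_X_mul_X _ _).add (isHomogeneous_X_pow _ 2)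
    · exact (isHomogeneous_X_mul_X _ _).add (isHomogeneous_C_mul_X_pow' _ _ 2)
    · exact isHomogeneous_X_mul_X _ _

lemma xiInvHom_isHomogeneous (hn : 3 ≤ n) (t : K) (j : Fin (n + 1)) :
    (xiInvHom hn t j).IsHomogeneous 4 := by
  induction j using Fin.cases with
  | zero => exact isHomogeneous_X_pow 0 4
  | succ i =>
    simp only [xiInvHom, Fin.cons_succ]
    split_ifs
    · exact (isHomogeneous_X_mul_X_pow _ _ 3).sub
        (((isHomogeneous_X_mul_X _ _).sub (isHomogeneous_C_mul_X_pow' _ _ 2)).pow 2)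
    · exact ((isHomogeneous_X_mul_X _ _).sub (isHomogeneous_C_mul_X_pow' _ _ 2)).mul
        (isHomogeneous_X_pow 0 2)
    · exact isHomogeneous_X_mul_X_pow _ _ 3

lemma xiInvHomZero_isHomogeneous (hn : 3 ≤ n) (j : Fin (n + 1)) :
    (xiInvHomZero K hn j).IsHomogeneous 2 := by
  induction j using Fin.cases with
  | zero => exact isHomogeneous_X_pow 0 2
  | succ i =>
    simp only [xiInvHomZero, Fin.cons_succ]
    split_ifs
    · exact (isHomogeneous_X_mul_X _ _).sub (isHomogeneous_X_pow _ 2)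
    · exact isHomogeneous_X_mul_X _ _

/-- At infinity, in the direction of `x_2`, the term `x_2 ^ 2` of the first affine coordinate
survives, whatever `t` is. -/
lemma xiHom_coprime (hn : 3 ≤ n) (t : K) (h : MvPolynomial (Fin (n + 1)) K)
    (hF : ∀ i, h ∣ xiHom hn t i) : IsUnit h := by
  refine isUnit_of_forall_dvd (m := 2) rfl (i := Fin.succ ⟨0, by omega⟩)
    (v := Pi.single (Fin.succ ⟨1, by omega⟩) 1) ?_ ?_ h hF
  · exact Pi.single_eq_of_ne (Fin.succ_ne_zero _).symm 1
  · simp [xiHom, -Fin.succ_mk]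

/-- In the direction of `x_3` the first affine coordinate takes the value `-t ^ 2`. For `t = 0` the
quartics share the factor `x_0 ^ 2`, which is why the degree drops. -/
lemma xiInvHom_coprime (hn : 3 ≤ n) {t : K} (ht : t ≠ 0) (h : MvPolynomial (Fin (n + 1)) K)
    (hF : ∀ i, h ∣ xiInvHom hn t i) : IsUnit h := by
  refine isUnit_of_forall_dvd (m := 4) rfl (i := Fin.succ ⟨0, by omega⟩)
    (v := Pi.single (Fin.succ ⟨2, by omega⟩) 1) ?_ ?_ h hF
  · exact Pi.single_eq_of_ne (Fin.succ_ne_zero _).symm 1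
  · simp [xiInvHom, ht, -Fin.succ_mk]

lemma xiInvHomZero_coprime (hn : 3 ≤ n) (h : MvPolynomial (Fin (n + 1)) K)
    (hF : ∀ i, h ∣ xiInvHomZero K hn i) : IsUnit h := by
  refine isUnit_of_forall_dvd (m := 2) rfl (i := Fin.succ ⟨0, by omega⟩)
    (v := Pi.single (Fin.succ ⟨1, by omega⟩) 1) ?_ ?_ h hF
  · exact Pi.single_eq_of_ne (Fin.succ_ne_zero _).symm 1
  · simp [xiInvHomZero, -Fin.succ_mk]

end Homogeneous

variable (k : Type u) [Field k]

/-- The inverse of the polynomial map `ξ`. -/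
def xiInvPoly (hn : 3 ≤ n) (i : Fin n) : MvPolynomial (Fin n) (Polynomial k) :=
  if i.val = 0 then X i - (X ⟨1, by omega⟩ - C Polynomial.X * X ⟨2, by omega⟩ ^ 2) ^ 2
  else if i.val = 1 then X i - C Polynomial.X * X ⟨2, by omega⟩ ^ 2
  else X i

/-- The automorphism of the polynomial ring given by `ξ`. -/
def xiEquiv (hn : 3 ≤ n) :
    MvPolynomial (Fin n) (Polynomial k) ≃ₐ[Polynomial k] MvPolynomial (Fin n) (Polynomial k) :=
  AlgEquiv.ofAlgHom (aeval (xiPoly k hn)) (aeval (xiInvPoly k hn))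
    (by
      have p0 : 0 < n := by omega
      have p1 : 1 < n := by omega
      ext i : 1
      simp only [xiInvPoly, AlgHom.comp_apply, aeval_X]
      split_ifs with h0 h1
      · obtain rfl : i = ⟨0, p0⟩ := Fin.ext h0
        simp [xiPoly]
      · obtain rfl : i = ⟨1, p1⟩ := Fin.ext h1
        simp [xiPoly]
      · simp [xiPoly, h0, h1])
    (by
      have p0 : 0 < n := by omega
      have p1 : 1 < n := by omega
      ext i : 1
      simp only [xiPoly, AlgHom.comp_apply, aeval_X]
      split_ifs with h0 h1
      · obtain rfl : i = ⟨0, p0⟩ := Fin.ext h0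
        simp [xiInvPoly]
      · obtain rfl : i = ⟨1, p1⟩ := Fin.ext h1
        simp [xiInvPoly]
      · simp [xiInvPoly, h0, h1])

lemma xiEquiv_X (hn : 3 ≤ n) (i : Fin n) : xiEquiv k hn (X i) = xiPoly k hn i := by
  simp [xiEquiv]

lemma xiEquiv_symm_X (hn : 3 ≤ n) (i : Fin n) : (xiEquiv k hn).symm (X i) = xiInvPoly k hn i := by
  simp [xiEquiv]

variable {k}

lemma chartVec_zero_zero (R : Type u) [CommRing R] : chartVec n R 0 0 = 1 := by
  simp [chartVec]

lemma chartVec_zero_succ (R : Type u) [CommRing R] (i : Fin n) : chartVec n R 0 i.succ = X i := by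
  simp [chartVec]

lemma xiHom_eval₂ (hn : 3 ≤ n) {K : Type u} [Field K] (c : Polynomial k →+* K) (j : Fin (n + 1)) :
    (xiHom hn (c Polynomial.X) j).eval₂ C (chartVec n K 0) =
      MvPolynomial.map c (xiEquiv k hn (chartVec n (Polynomial k) 0 j)) := by
  induction j using Fin.cases with
  | zero => simp [xiHom, chartVec_zero_zero]
  | succ i =>
    simp only [xiHom, chartVec_zero_succ, Fin.cons_succ, xiEquiv_X, xiPoly]
    split_ifs <;> simp [chartVec_zero_zero, chartVec_zero_succ, -Fin.succ_mk]

lemma xiInvHom_eval₂ (hn : 3 ≤ n) {K : Type u} [Field K] (c : Polynomial k →+* K)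
    (j : Fin (n + 1)) :
    (xiInvHom hn (c Polynomial.X) j).eval₂ C (chartVec n K 0) =
      MvPolynomial.map c ((xiEquiv k hn).symm (chartVec n (Polynomial k) 0 j)) := by
  induction j using Fin.cases with
  | zero => simp [xiInvHom, chartVec_zero_zero]
  | succ i =>
    simp only [xiInvHom, chartVec_zero_succ, Fin.cons_succ, xiEquiv_symm_X, xiInvPoly]
    split_ifs <;> simp [chartVec_zero_zero, chartVec_zero_succ, -Fin.succ_mk]

lemma xiInvHomZero_eval₂ (hn : 3 ≤ n) {K : Type u} [Field K] (c : Polynomial k →+* K)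
    (hc : c Polynomial.X = 0) (j : Fin (n + 1)) :
    (xiInvHomZero K hn j).eval₂ C (chartVec n K 0) =
      MvPolynomial.map c ((xiEquiv k hn).symm (chartVec n (Polynomial k) 0 j)) := by
  induction j using Fin.cases with
  | zero => simp [xiInvHomZero, chartVec_zero_zero]
  | succ i =>
    simp only [xiInvHomZero, chartVec_zero_succ, Fin.cons_succ, xiEquiv_symm_X, xiInvPoly]
    split_ifs <;> simp [hc, chartVec_zero_zero, chartVec_zero_succ, -Fin.succ_mk]

end Xi

/-! ### The family over the affine line and its degrees. -/

section Family

open MvPolynomial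

variable {n : ℕ} (k : Type u) [Field k]

/-- The coordinate ring of the affine line. -/
abbrev LineRing : CommRingCat.{u} := .of (Polynomial k)

/-- The structure morphism of the affine line, as a morphism of spectra. -/
abbrev lineStr : Spec (LineRing k) ⟶ Spec (.of k) := Line.str k

/-- The standard representative of the family `ξ`. -/
def xiRep (hn : 3 ≤ n) : BirRep (ProjSpace.str n k) (lineStr k) :=
  affineRep (lineStr k) (xiEquiv k hn).toRingEquiv fun r ↦ (xiEquiv k hn).commutes r

lemma baseHom_lineStr : baseHom (lineStr k) = algebraMap k (Polynomial k) :=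
  congr(($(Spec.preimage_map (CommRingCat.ofHom (algebraMap k (Polynomial k))))).hom)

lemma C_comp_baseHom_lineStr :
    C.comp (baseHom (lineStr k)) = algebraMap k (MvPolynomial (Fin n) (Polynomial k)) := by
  rw [baseHom_lineStr]
  rfl

variable {k}

lemma projPoint_congr {R : Type u} [CommRing R] {c c' : k →+* R} {v v' : Fin (n + 1) → R}
    {hv : Ideal.span (Set.range v) = ⊤} {hv' : Ideal.span (Set.range v') = ⊤} (hc : c = c')
    (h : v = v') : projPoint c v hv = projPoint c' v' hv' := by
  subst hc h
  rfl

lemma isAffineRep_xiRep (hn : 3 ≤ n) :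
    IsAffineRep (xiRep k hn) (xiEquiv k hn).toRingEquiv.toRingHom :=
  isAffineRep_affineRep _ _

lemma isAffineRep_xiRep_inv (hn : 3 ≤ n) :
    IsAffineRep (xiRep k hn).inv (xiEquiv k hn).toRingEquiv.symm.toRingHom :=
  isAffineRep_affineRep_inv _ _

lemma extendsAffineFamily_xiRep (hn : 3 ≤ n) :
    ExtendsAffineFamily (Bir.mk (xiRep k hn)) (xiPoly k hn) := by
  obtain ⟨j, hj₁, hj₂⟩ := isAffineRep_xiRep (k := k) hn
  refine ⟨xiRep k hn, rfl, j.hom, ?_, ?_, ?_⟩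
  · have h := affineChart_fst (n := n) (lineStr k) 0
    rw [← hj₁, Category.assoc] at h
    exact h
  · have h := affineChart_snd (n := n) (lineStr k) 0
    rw [← hj₁, Category.assoc] at h
    refine h.trans (projPoint_congr (C_comp_baseHom_lineStr k) ?_)
    simp only [chartVec, Fin.insertNth_zero]
    rfl
  · have h := affineChart_snd (n := n) (lineStr k) 0
    have h' := congr($hj₂ ≫ pullback.snd (lineStr k) (ProjSpace.str n k))
    rw [Category.assoc, Category.assoc, h, specMap_projPoint _ _ _ _ (isUnit_chartVec _ 0)] at h'
    refine h'.trans (projPoint_congr ?_ ?_)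
    · rw [← C_comp_baseHom_lineStr]
      refine RingHom.ext fun r ↦ ?_
      exact (xiEquiv k hn).commutes _
    · ext1 j
      induction j using Fin.cases with
      | zero =>
        rw [chartVec_zero_zero]
        exact map_one (xiEquiv k hn)
      | succ i =>
        rw [chartVec_zero_succ]
        exact xiEquiv_X k hn i

variable {K : CommRingCat.{u}}

/-- The parameter of a point of the affine line. -/
abbrev param (g : Spec K ⟶ Spec (LineRing k)) : K := (Spec.preimage g).hom Polynomial.X

lemma hasDegree_xi (hn : 3 ≤ n) (hK : IsField K) (g : Spec K ⟶ Spec (LineRing k)) :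
    HasDegree ((Bir.mk (xiRep k hn)).pull g) 2 := by
  let := hK.toField
  exact hasDegree_pull (isAffineRep_xiRep hn) (fun r ↦ (xiEquiv k hn).commutes r)
    (xiHom_isHomogeneous hn (param g)) (xiHom_coprime hn _) (xiHom_eval₂ hn _)

lemma hasDegree_xi_pull_inv (hn : 3 ≤ n) (hK : IsField K) (g : Spec K ⟶ Spec (LineRing k))
    (hg : param g ≠ 0) : HasDegree ((Bir.mk (xiRep k hn)).pull g).inv 4 := by
  let := hK.toField
  exact hasDegree_pull_inv (τ' := (xiEquiv k hn).toRingEquiv.symm.toRingHom)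
    (isAffineRep_xiRep hn) (fun r ↦ (xiEquiv k hn).commutes r)
    (RingEquiv.toRingHom_comp_symm_toRingHom _)
    (xiInvHom_isHomogeneous hn (param g)) (xiInvHom_coprime hn hg) (xiInvHom_eval₂ hn _)

lemma hasDegree_xi_pull_inv_zero (hn : 3 ≤ n) (hK : IsField K) (g : Spec K ⟶ Spec (LineRing k))
    (hg : param g = 0) : HasDegree ((Bir.mk (xiRep k hn)).pull g).inv 2 := by
  let := hK.toField
  exact hasDegree_pull_inv (τ' := (xiEquiv k hn).toRingEquiv.symm.toRingHom)
    (isAffineRep_xiRep hn) (fun r ↦ (xiEquiv k hn).commutes r)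
    (RingEquiv.toRingHom_comp_symm_toRingHom _)
    (xiInvHomZero_isHomogeneous hn) (xiInvHomZero_coprime hn) (xiInvHomZero_eval₂ hn _ hg)

lemma hasDegree_xi_inv_pull (hn : 3 ≤ n) (hK : IsField K) (g : Spec K ⟶ Spec (LineRing k))
    (hg : param g ≠ 0) : HasDegree ((Bir.mk (xiRep k hn).inv).pull g) 4 := by
  let := hK.toField
  exact hasDegree_pull (isAffineRep_xiRep_inv hn) (fun r ↦ (xiEquiv k hn).symm.commutes r)
    (xiInvHom_isHomogeneous hn (param g)) (xiInvHom_coprime hn hg) (xiInvHom_eval₂ hn _)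

lemma hasDegree_xi_inv_pull_zero (hn : 3 ≤ n) (hK : IsField K) (g : Spec K ⟶ Spec (LineRing k))
    (hg : param g = 0) : HasDegree ((Bir.mk (xiRep k hn).inv).pull g) 2 := by
  let := hK.toField
  exact hasDegree_pull (isAffineRep_xiRep_inv hn) (fun r ↦ (xiEquiv k hn).symm.commutes r)
    (xiInvHomZero_isHomogeneous hn) (xiInvHomZero_coprime hn) (xiInvHomZero_eval₂ hn _ hg)

/-- The `k`-point `t` of the affine line, as a morphism of spectra. -/
abbrev linePt (t : k) : Spec (.of k) ⟶ Spec (LineRing k) := Line.pt t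

lemma param_linePt (t : k) : param (linePt t) = t := by
  have h : Spec.preimage (linePt t) = CommRingCat.ofHom (Polynomial.evalRingHom t) :=
    Spec.preimage_map _
  rw [param, h]
  exact Polynomial.eval_X

/-- Translates vanishing of the parameter into a condition on the image prime, so that residue-field
points can be treated like `k`-points. -/
lemma param_eq_zero_iff (hK : IsField K) (g : Spec K ⟶ Spec (LineRing k)) (y : ↥(Spec K)) :
    param g = 0 ↔ Polynomial.X ∈ PrimeSpectrum.asIdeal (R := Polynomial k) (g y) := by
  let := hK.toField
  have hy : PrimeSpectrum.asIdeal (R := K) y = ⊥ :=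
    (eq_bot_or_eq_top _).resolve_right (PrimeSpectrum.isPrime (R := K) y).ne_top
  have h : param g ∈ PrimeSpectrum.asIdeal (R := K) y ↔ param g = 0 := by
    rw [hy, Ideal.mem_bot]
  rw [← h]
  conv_rhs => rw [← Spec.map_preimage g]
  rfl

lemma param_fromSpecResidueField (a : ↥(Spec (LineRing k))) :
    param ((Spec (LineRing k)).fromSpecResidueField a) = 0 ↔
      Polynomial.X ∈ PrimeSpectrum.asIdeal (R := Polynomial k) a := by
  rw [param_eq_zero_iff (Field.toIsField _) _ (Nonempty.some inferInstance),
    Scheme.fromSpecResidueField_apply]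

lemma isField_residueField {X : Scheme.{u}} (a : X) : IsField (X.residueField a) :=
  Field.toIsField _

lemma xi_mem_birDeg (hn : 3 ≤ n) : Bir.mk (xiRep k hn) ∈ birDeg (Line.str k) :=
  fun _ ↦ ⟨2, fun a _ ↦ hasDegree_xi hn (isField_residueField a) _⟩

lemma xi_inv_notMem_birDeg (hn : 3 ≤ n) :
    (Bir.mk (xiRep k hn)).inv ∉ birDeg (Line.str k) := by
  intro h
  have hp : (Ideal.span {(Polynomial.X : Polynomial k)}).IsPrime :=
    (Ideal.span_singleton_prime Polynomial.X_ne_zero).mpr Polynomial.prime_X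
  -- The origin and the generic point of the connected line: the inverse has degree 2 at the first
  -- and 4 at the second.
  let a : ↥(Spec (LineRing k)) := (⟨Ideal.span {Polynomial.X}, hp⟩ : PrimeSpectrum (Polynomial k))
  let b : ↥(Spec (LineRing k)) := (⊥ : PrimeSpectrum (Polynomial k))
  obtain ⟨d, hd⟩ := h a
  have hconn : connectedComponent a = Set.univ :=
    (PreconnectedSpace.connectedComponent_eq_univ (X := PrimeSpectrum (Polynomial k)) a)
  have ha := hd a (hconn ▸ Set.mem_univ _)
  have hb := hd b (hconn ▸ Set.mem_univ _)
  have h2 := hasDegree_xi_inv_pull_zero hn (isField_residueField a) _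
    ((param_fromSpecResidueField a).mpr (Ideal.mem_span_singleton_self _))
  have h4 := hasDegree_xi_inv_pull hn (isField_residueField b) _
    (mt (param_fromSpecResidueField b).mp Polynomial.X_ne_zero)
  have e2 := HasDegree.unique (isField_residueField a) ha h2
  have e4 := HasDegree.unique (isField_residueField b) hb h4
  omega

end Family

/-! ### Closures and supports of graphs. -/

section Graph

variable {X S A B : Scheme.{u}} {πX : X ⟶ S} {πA : A ⟶ S}

lemma graphMap_fst (φ : BirRep πX πA) : φ.graphMap ≫ pullback.fst _ _ = φ.source.ι :=
  pullback.lift_fst _ _ _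

lemma graphMap_snd (φ : BirRep πX πA) : φ.graphMap ≫ pullback.snd _ _ = φ.hom :=
  pullback.lift_snd _ _ _

lemma preirreducibleSpace_opens {Y : Scheme.{u}} [PreirreducibleSpace ↥Y] (U : Y.Opens) :
    PreirreducibleSpace ↥U.toScheme :=
  Subtype.preirreducibleSpace
    (PreirreducibleSpace.isPreirreducible_univ.open_subset U.2 (Set.subset_univ _))

/-- A nonempty open subset of an irreducible space is dense, so restricting to it does not shrink
the closure of the image. -/
lemma closure_range_homOfLE_comp {Y Z : Scheme.{u}} [PreirreducibleSpace ↥Y] {W U : Y.Opens}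
    (h : W ≤ U) [Nonempty ↥W.toScheme] (f : U.toScheme ⟶ Z) :
    closure (Set.range (Y.homOfLE h ≫ f)) = closure (Set.range f) := by
  have := preirreducibleSpace_opens U
  have hd : DenseRange (Y.homOfLE h) :=
    (Y.homOfLE h).isOpenEmbedding.isOpenMap.denseRange_of_isPreirreducibleSpace
  refine subset_antisymm (closure_mono ?_) (closure_minimal ?_ isClosed_closure)
  · rintro _ ⟨x, rfl⟩
    exact ⟨_, rfl⟩
  · rintro _ ⟨x, rfl⟩
    have h1 := image_closure_subset_closure_image f.continuous ⟨x, hd x, rfl⟩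
    rwa [← Set.range_comp] at h1

/-- The closure of the graph does not depend on the representative. -/
lemma closure_range_graphMap_eq [PreirreducibleSpace ↥(pullback πA πX)] [Nonempty ↥A]
    {φ ψ : BirRep πX πA} (h : Bir.mk φ = Bir.mk ψ) :
    closure (Set.range φ.graphMap) = closure (Set.range ψ.graphMap) := by
  let T : Bir πX πA → Set ↥(pullback (pullback.fst πA πX) (pullback.fst πA πX)) :=
    Quot.lift (fun φ ↦ closure (Set.range φ.graphMap)) (by
      rintro φ ψ ⟨W, h₁, h₂, hs, e⟩
      have : Nonempty ↥W.toScheme := ⟨(hs.surj (Nonempty.some inferInstance)).choose⟩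
      have e' : (pullback πA πX).homOfLE h₁ ≫ φ.graphMap =
          (pullback πA πX).homOfLE h₂ ≫ ψ.graphMap := by
        apply pullback.hom_ext
        · rw [Category.assoc, Category.assoc, graphMap_fst, graphMap_fst, Scheme.homOfLE_ι,
            Scheme.homOfLE_ι]
        · rw [Category.assoc, Category.assoc, graphMap_snd, graphMap_snd, e]
      rw [← closure_range_homOfLE_comp h₁, e', closure_range_homOfLE_comp h₂])
  exact congrArg T h

/-- The graph is closed over the domain of definition. -/
lemma mem_range_graphMap [IsSeparated πX] (ψ : BirRep πX πA)
    {z : ↥(pullback (pullback.fst πA πX) (pullback.fst πA πX))}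
    (hz : z ∈ closure (Set.range ψ.graphMap))
    (hz' : pullback.fst (pullback.fst πA πX) (pullback.fst πA πX) z ∈ ψ.source) :
    z ∈ Set.range ψ.graphMap := by
  let p₁ := pullback.fst (pullback.fst πA πX) (pullback.fst πA πX)
  have hsub : Set.range ψ.graphMap ⊆ Set.range (p₁ ⁻¹ᵁ ψ.source).ι := by
    rintro _ ⟨x, rfl⟩
    rw [Scheme.Opens.range_ι]
    change (ψ.graphMap ≫ p₁) x ∈ ψ.source
    rw [graphMap_fst]
    exact x.2
  let γ : ψ.source.toScheme ⟶ (p₁ ⁻¹ᵁ ψ.source).toScheme :=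
    IsOpenImmersion.lift (p₁ ⁻¹ᵁ ψ.source).ι ψ.graphMap hsub
  have hγ : γ ≫ (p₁ ⁻¹ᵁ ψ.source).ι = ψ.graphMap := IsOpenImmersion.lift_fac _ _ _
  -- Over `ψ.source` the graph is a section of a base change of the separated `πX`, hence a closed
  -- immersion.
  have hsec : γ ≫ (p₁ ∣_ ψ.source) = 𝟙 _ := by
    rw [← cancel_mono ψ.source.ι, Category.assoc, morphismRestrict_ι, reassoc_of% hγ, graphMap_fst,
      Category.id_comp]
  have : IsClosedImmersion (γ ≫ (p₁ ∣_ ψ.source)) := by rw [hsec]; infer_instance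
  have : IsClosedImmersion γ := IsClosedImmersion.of_comp γ (p₁ ∣_ ψ.source)
  have hcl : IsClosed (Set.range γ) := γ.isClosedEmbedding.isClosed_range
  let z' : ↥(p₁ ⁻¹ᵁ ψ.source).toScheme := ⟨z, hz'⟩
  have hzz' : (p₁ ⁻¹ᵁ ψ.source).ι z' = z := rfl
  have h1 : z' ∈ closure (Set.range γ) := by
    rw [(p₁ ⁻¹ᵁ ψ.source).ι.isOpenEmbedding.isInducing.closure_eq_preimage_closure_image,
      ← Set.range_comp, Set.mem_preimage, hzz']
    rw [← hγ] at hz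
    exact hz
  rw [hcl.closure_eq] at h1
  obtain ⟨w, hw⟩ := h1
  refine ⟨w, ?_⟩
  rw [← hγ, ← hzz', ← hw]
  rfl

/-- The support of the graph is the closure of the set-theoretic graph. -/
lemma support_graph [IsLocallyNoetherian (pullback πA πX)] [IsSeparated πX] (ψ : BirRep πX πA) :
    (ψ.graph.support : Set ↥(pullback (pullback.fst πA πX) (pullback.fst πA πX))) =
      closure (Set.range ψ.graphMap) := by
  have : QuasiCompact (ψ.graphMap ≫
      pullback.fst (pullback.fst πA πX) (pullback.fst πA πX)) := by
    rw [graphMap_fst]; infer_instance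
  have : QuasiCompact ψ.graphMap := QuasiCompact.of_comp _
    (pullback.fst (pullback.fst πA πX) (pullback.fst πA πX))
  have h := Scheme.Hom.support_ker ψ.graphMap
  rw [BirRep.graph, h]

/-- The map from the domain of the base change to the domain of the transformation is compatible
with the graphs. -/
lemma graphMap_pull (φ : BirRep πX πA) (g : B ⟶ A) :
    (φ.pull g).graphMap ≫ prodMap₂ πX πA g = pullSourceMap φ g ≫ φ.graphMap := by
  apply pullback.hom_ext
  · rw [Category.assoc, Category.assoc, graphMap_fst, pullSourceMap_ι, prodMap₂, pullback.map,
      pullback.lift_fst, reassoc_of% graphMap_fst]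
  · rw [Category.assoc, Category.assoc, graphMap_snd, pullSourceMap_hom, prodMap₂,
      pullback.map, pullback.lift_snd, reassoc_of% graphMap_snd]

end Graph

/-! ### An open condition that separates two morphisms. -/

section Detect

/-- For two morphisms `m₁, m₂ : Z ⟶ Y`, an affine open subscheme of `Y` and a function `r` on it,
the points where both `m_i` land in the affine open and the pullbacks of `r` differ are those of an
open set. -/
lemma exists_opens_ne {Z Y : Scheme.{u}} {R : CommRingCat.{u}} (m₁ m₂ : Z ⟶ Y) (i : Spec R ⟶ Y)
    [IsOpenImmersion i] (r : R) :
    ∃ O : Z.Opens, ∀ (L : Type u) [Field L] (q : Spec (.of L) ⟶ Z) (y : ↥(Spec (.of L))),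
      q y ∈ O ↔ ∃ g₁ g₂ : R →+* L, q ≫ m₁ = Spec.map (CommRingCat.ofHom g₁) ≫ i ∧
        q ≫ m₂ = Spec.map (CommRingCat.ofHom g₂) ≫ i ∧ g₁ r ≠ g₂ r := by
  -- `Ω` is the open part of `Z` that both morphisms send into `Spec R`; the desired set is the
  -- locus in it where the difference of the two pullbacks of `r` is invertible.
  let Ω := pullback (pullback.fst m₁ i ≫ m₂) i
  let o : Ω ⟶ Z := pullback.fst (pullback.fst m₁ i ≫ m₂) i ≫ pullback.fst m₁ i
  let a : Ω ⟶ Spec R := pullback.fst (pullback.fst m₁ i ≫ m₂) i ≫ pullback.snd m₁ i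
  let b : Ω ⟶ Spec R := pullback.snd (pullback.fst m₁ i ≫ m₂) i
  have ha : o ≫ m₁ = a ≫ i := by simp only [o, a, Category.assoc, pullback.condition]
  have hb : o ≫ m₂ = b ≫ i := by
    simp only [o, b, ← pullback.condition, Category.assoc]
  let r' : Γ(Spec R, ⊤) := (Scheme.ΓSpecIso R).inv r
  let f : Γ(Ω, ⊤) := a.appTop r' - b.appTop r'
  refine ⟨o ''ᵁ Ω.basicOpen f, fun L _ q y ↦ ?_⟩
  have key : ∀ (q' : Spec (.of L) ⟶ Ω) (y) (g₁ g₂ : R →+* L),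
      q' ≫ a = Spec.map (CommRingCat.ofHom g₁) → q' ≫ b = Spec.map (CommRingCat.ofHom g₂) →
      (q' y ∈ Ω.basicOpen f ↔ g₁ r ≠ g₂ r) := by
    intro q' y g₁ g₂ h₁ h₂
    have h0 : ∀ (c : Ω ⟶ Spec R) (g : R →+* L), q' ≫ c = Spec.map (CommRingCat.ofHom g) →
        q'.appTop (c.appTop r') = (Scheme.ΓSpecIso (.of L)).inv (g r) := by
      intro c g h
      have h3 := congrArg (fun z ↦ z.appTop r') h
      simp only [Scheme.Hom.comp_appTop, CommRingCat.comp_apply] at h3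
      rw [h3]
      exact (ConcreteCategory.congr_hom
        (Scheme.ΓSpecIso_inv_naturality (CommRingCat.ofHom g)) r).symm
    have h1 : q'.appTop f = (Scheme.ΓSpecIso (.of L)).inv (g₁ r - g₂ r) := by
      rw [map_sub, map_sub, h0 a g₁ h₁, h0 b g₂ h₂]
    have h2 : q' y ∈ Ω.basicOpen f ↔
        y ∈ (Spec (.of L)).basicOpen ((Scheme.ΓSpecIso (.of L)).inv (g₁ r - g₂ r)) := by
      rw [← h1]
      exact iff_of_eq (congrArg (y ∈ ·) (Scheme.preimage_basicOpen_top q' f))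
    rw [h2]
    constructor
    · intro h hr
      rw [hr, sub_self, map_zero, Scheme.basicOpen_zero] at h
      exact h
    · intro h
      rw [Scheme.basicOpen_of_isUnit _ ((IsUnit.mk0 _ (sub_ne_zero.mpr h)).map
        (Scheme.ΓSpecIso (.of L)).inv.hom)]
      trivial
  constructor
  · rintro ⟨w, hw, hwq⟩
    have hsub : Set.range q ⊆ Set.range o := by
      rintro _ ⟨y', rfl⟩
      exact ⟨w, hwq.trans (congrArg q (Subsingleton.elim y y'))⟩
    let q' := IsOpenImmersion.lift o q hsub
    have hq' : q' ≫ o = q := IsOpenImmersion.lift_fac _ _ _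
    have hy : q' y = w := o.isOpenEmbedding.injective (by
      refine Eq.trans ?_ hwq.symm
      rw [← Scheme.Hom.comp_apply, hq'])
    let g₁ : R →+* L := (Spec.preimage (q' ≫ a)).hom
    let g₂ : R →+* L := (Spec.preimage (q' ≫ b)).hom
    have h₁ : q' ≫ a = Spec.map (CommRingCat.ofHom g₁) := (Spec.map_preimage (q' ≫ a)).symm
    have h₂ : q' ≫ b = Spec.map (CommRingCat.ofHom g₂) := (Spec.map_preimage (q' ≫ b)).symm
    refine ⟨g₁, g₂, ?_, ?_, (key q' y g₁ g₂ h₁ h₂).mp (hy.symm ▸ hw)⟩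
    · rw [← h₁, Category.assoc, ← ha, reassoc_of% hq']
    · rw [← h₂, Category.assoc, ← hb, reassoc_of% hq']
  · rintro ⟨g₁, g₂, h₁, h₂, hr⟩
    let q' : Spec (.of L) ⟶ Ω := pullback.lift (pullback.lift q _ h₁)
      (Spec.map (CommRingCat.ofHom g₂))
      (by rw [pullback.lift_fst_assoc, h₂])
    have hq' : q' ≫ o = q := by simp only [q', o, pullback.lift_fst, pullback.lift_fst_assoc]
    refine ⟨q' y, (key q' y g₁ g₂ ?_ ?_).mpr hr, ?_⟩
    · simp only [q', a, pullback.lift_fst_assoc, pullback.lift_snd]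
    · simp only [q', b, pullback.lift_snd]
    · rw [← hq']
      rfl

end Detect

/-! ### Sections of `ℙⁿ × ℙⁿ` over an affine base. -/

section BiPoint

variable {X S A B : Scheme.{u}} {πX : X ⟶ S} {πA : A ⟶ S}

/-- Both factors have the same projection to `A`, so three components suffice instead of four. -/
lemma biprod_hom_ext {f g : B ⟶ pullback (pullback.fst πA πX) (pullback.fst πA πX)}
    (h₁ : f ≫ pullback.fst _ _ ≫ pullback.fst _ _ = g ≫ pullback.fst _ _ ≫ pullback.fst _ _)
    (h₂ : f ≫ pullback.fst _ _ ≫ pullback.snd _ _ = g ≫ pullback.fst _ _ ≫ pullback.snd _ _)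
    (h₃ : f ≫ pullback.snd _ _ ≫ pullback.snd _ _ = g ≫ pullback.snd _ _ ≫ pullback.snd _ _) :
    f = g := by
  apply pullback.hom_ext <;> apply pullback.hom_ext
  · simpa using h₁
  · simpa using h₂
  · simpa [pullback.condition] using h₁
  · simpa using h₃

variable {n : ℕ} {k : Type u} [Field k] {R R' : CommRingCat.{u}} (s : Spec R ⟶ Spec (.of k))
  {v w : Fin (n + 1) → R} {i : Fin (n + 1)} (hv : IsUnit (v i)) (hw : IsUnit (w i))

/-- The section `([v], [w])` of `ℙⁿ × ℙⁿ` over `Spec R`. -/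
def biPoint : Spec R ⟶ pullback (pullback.fst s (ProjSpace.str n k))
    (pullback.fst s (ProjSpace.str n k)) :=
  pullback.lift
    (pullback.lift (𝟙 _) (projPoint (baseHom s) v (span_eq_top_of_isUnit hv))
      (by rw [projPoint_str _ _ _ hv, specMap_baseHom, Category.id_comp]))
    (pullback.lift (𝟙 _) (projPoint (baseHom s) w (span_eq_top_of_isUnit hw))
      (by rw [projPoint_str _ _ _ hw, specMap_baseHom, Category.id_comp]))
    (by rw [pullback.lift_fst, pullback.lift_fst])

lemma biPoint_fst_fst : biPoint s hv hw ≫ pullback.fst _ _ ≫ pullback.fst _ _ = 𝟙 _ := by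
  rw [biPoint, pullback.lift_fst_assoc, pullback.lift_fst]

lemma biPoint_fst_snd : biPoint s hv hw ≫ pullback.fst _ _ ≫ pullback.snd _ _ =
    projPoint (baseHom s) v (span_eq_top_of_isUnit hv) := by
  rw [biPoint, pullback.lift_fst_assoc, pullback.lift_snd]

lemma biPoint_snd_snd : biPoint s hv hw ≫ pullback.snd _ _ ≫ pullback.snd _ _ =
    projPoint (baseHom s) w (span_eq_top_of_isUnit hw) := by
  rw [biPoint, pullback.lift_snd_assoc, pullback.lift_snd]

lemma specMap_comp_projPoint (g : Spec R' ⟶ Spec R) :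
    g ≫ projPoint (baseHom s) v (span_eq_top_of_isUnit hv) =
      projPoint (baseHom (g ≫ s)) (fun j ↦ (Spec.preimage g).hom (v j))
        (span_eq_top_of_isUnit (hv.map (Spec.preimage g).hom)) := by
  have h := specMap_projPoint (Spec.preimage g).hom (baseHom s) v (span_eq_top_of_isUnit hv) hv
  rw [CommRingCat.ofHom_hom, Spec.map_preimage] at h
  refine h.trans (projPoint_congr ?_ rfl)
  rw [baseHom, baseHom, Spec.preimage_comp]
  rfl

lemma biPoint_pull (g : Spec R' ⟶ Spec R) :
    biPoint (g ≫ s) (v := fun j ↦ (Spec.preimage g).hom (v j))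
        (w := fun j ↦ (Spec.preimage g).hom (w j)) (hv.map (Spec.preimage g).hom)
        (hw.map (Spec.preimage g).hom) ≫ prodMap₂ (ProjSpace.str n k) s g = g ≫ biPoint s hv hw := by
  have h₁ : prodMap₂ (ProjSpace.str n k) s g ≫ pullback.fst _ _ = pullback.fst _ _ ≫
    prodMap (ProjSpace.str n k) s g := pullback.lift_fst _ _ _
  have h₂ : prodMap₂ (ProjSpace.str n k) s g ≫ pullback.snd _ _ = pullback.snd _ _ ≫
    prodMap (ProjSpace.str n k) s g := pullback.lift_snd _ _ _
  apply biprod_hom_ext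
  · rw [Category.assoc, Category.assoc, biPoint_fst_fst, reassoc_of% h₁, prodMap_fst,
      reassoc_of% biPoint_fst_fst, Category.comp_id]
  · rw [Category.assoc, Category.assoc, biPoint_fst_snd, reassoc_of% h₁, prodMap_snd,
      specMap_comp_projPoint _ hv]
    exact biPoint_fst_snd _ _ _
  · rw [Category.assoc, Category.assoc, biPoint_snd_snd, reassoc_of% h₂, prodMap_snd,
      specMap_comp_projPoint _ hw]
    exact biPoint_snd_snd _ _ _

end BiPoint

/-! ### The limit point of the graph at `t = 0`. -/

section Limit

open MvPolynomial

variable {n : ℕ} {k : Type u} [Field k]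

/-- The homogeneous coordinates of the point `(0, 0, 1/T, 0, …, 0)`, multiplied by `T`. -/
def curveX (n : ℕ) {R : Type u} [CommRing R] (T : R) (j : Fin (n + 1)) : R :=
  if j.val = 0 then T else if j.val = 3 then 1 else 0

/-- The homogeneous coordinates of the image `(0, 1/T, 1/T, 0, …, 0)` of
`(0, 0, 1/T, 0, …, 0)` under `ξ(T)`, multiplied by `T`. -/
def curveY (n : ℕ) {R : Type u} [CommRing R] (T : R) (j : Fin (n + 1)) : R :=
  if j.val = 0 then T else if j.val = 2 ∨ j.val = 3 then 1 else 0

/-- The index of the homogeneous coordinate `x_3`. -/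
abbrev idx₃ (hn : 3 ≤ n) : Fin (n + 1) := ⟨3, by omega⟩

/-- The index of the homogeneous coordinate `x_2`. -/
abbrev idx₂ (hn : 3 ≤ n) : Fin (n + 1) := ⟨2, by omega⟩

lemma isUnit_curveX (hn : 3 ≤ n) {R : Type u} [CommRing R] (T : R) :
    IsUnit (curveX n T (idx₃ hn)) := by
  simp [curveX]

lemma isUnit_curveY (hn : 3 ≤ n) {R : Type u} [CommRing R] (T : R) :
    IsUnit (curveY n T (idx₃ hn)) := by
  simp [curveY]

lemma map_curveX {R R' : Type u} [CommRing R] [CommRing R'] (g : R →+* R') (T : R)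
    (j : Fin (n + 1)) : g (curveX n T j) = curveX n (g T) j := by
  simp only [curveX, apply_ite g, map_one, map_zero]

lemma map_curveY {R R' : Type u} [CommRing R] [CommRing R'] (g : R →+* R') (T : R)
    (j : Fin (n + 1)) : g (curveY n T j) = curveY n (g T) j := by
  simp only [curveY, apply_ite g, map_one, map_zero]

/-- A curve in `𝔸¹ × ℙⁿ × ℙⁿ` that lies in the closure of the graph of `ξ`. -/
def graphCurve (k : Type u) [Field k] (hn : 3 ≤ n) : Spec (LineRing k) ⟶
    pullback (pullback.fst (lineStr k) (ProjSpace.str n k))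
      (pullback.fst (lineStr k) (ProjSpace.str n k)) :=
  biPoint (R := LineRing k) (lineStr k) (isUnit_curveX hn (Polynomial.X : Polynomial k))
    (isUnit_curveY hn (Polynomial.X : Polynomial k))

/-- Away from `t = 0`, the curve lies in the graph. -/
lemma exists_comp_graphMap (hn : 3 ≤ n) {L : Type u} [Field L] (e : Polynomial k →+* L)
    (he : e Polynomial.X ≠ 0) :
    ∃ p : Spec (.of L) ⟶ (xiRep k hn).source.toScheme,
      p ≫ (xiRep k hn).graphMap = Spec.map (CommRingCat.ofHom e) ≫ graphCurve k hn := by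
  obtain ⟨j, hj₁, hj₂⟩ := isAffineRep_xiRep (k := k) hn
  -- The point `(0, 0, 1/T, 0, …, 0)` with `T` the value of the parameter. Multiplying its
  -- homogeneous coordinates, and those of its image, by `T` gives the two vectors that define the
  -- curve.
  let ω : MvPolynomial (Fin n) (Polynomial k) →+* L :=
    eval₂Hom e (fun i ↦ if i.val = 2 then (e Polynomial.X)⁻¹ else 0)
  have hωX : ∀ i, ω (X i) = if i.val = 2 then (e Polynomial.X)⁻¹ else 0 := fun i ↦
    eval₂Hom_X' _ _ _
  have hωC : ∀ r, ω (C r) = e r := fun r ↦ eval₂Hom_C _ _ _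
  have hωc : ω.comp (C.comp (baseHom (lineStr k))) = e.comp (baseHom (lineStr k)) :=
    RingHom.ext fun r ↦ hωC _
  refine ⟨Spec.map (CommRingCat.ofHom ω) ≫ j.hom, ?_⟩
  apply biprod_hom_ext
  · rw [Category.assoc, Category.assoc, Category.assoc, reassoc_of% graphMap_fst, reassoc_of% hj₁,
      affineChart_fst, graphCurve, biPoint_fst_fst, Category.comp_id, ← Spec.map_comp]
    exact congrArg (fun c ↦ Spec.map (CommRingCat.ofHom c))
      (RingHom.ext hωC : ω.comp C = e)
  · rw [Category.assoc, Category.assoc, Category.assoc, reassoc_of% graphMap_fst, reassoc_of% hj₁,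
      affineChart_snd, graphCurve, biPoint_fst_snd, specMap_projPoint _ _ _ _ (isUnit_chartVec _ 0),
      specMap_projPoint _ _ _ _ (isUnit_curveX hn _)]
    simp only [hωc]
    refine projPoint_eq_iff.mpr ⟨e Polynomial.X, he, fun i ↦ ?_⟩
    rw [map_curveX]
    induction i using Fin.cases with
    | zero => simp [chartVec_zero_zero, curveX]
    | succ i =>
      rw [chartVec_zero_succ, hωX]
      simp only [curveX, Fin.val_succ]
      split_ifs <;> first | contradiction | omega | simp [he]
  · rw [Category.assoc, Category.assoc, Category.assoc, reassoc_of% graphMap_snd, reassoc_of% hj₂,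
      affineChart_snd, graphCurve, biPoint_snd_snd, specMap_projPoint _ _ _ _ (isUnit_chartVec _ 0),
      specMap_projPoint _ _ _ _ ((isUnit_chartVec _ 0).map _),
      specMap_projPoint _ _ _ _ (isUnit_curveY hn _)]
    have hτ : ∀ r, (xiEquiv k hn).toRingEquiv.toRingHom (C r) = C r :=
      fun r ↦ (xiEquiv k hn).commutes r
    have hc : ω.comp ((xiEquiv k hn).toRingEquiv.toRingHom.comp (C.comp (baseHom (lineStr k)))) =
        e.comp (baseHom (lineStr k)) :=
      RingHom.ext fun r ↦ (congrArg ω (hτ _)).trans (hωC _)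
    simp only [hc]
    refine projPoint_eq_iff.mpr ⟨e Polynomial.X, he, fun i ↦ ?_⟩
    rw [map_curveY]
    induction i using Fin.cases with
    | zero => simp [chartVec_zero_zero, curveY]
    | succ i =>
      have h : (xiEquiv k hn).toRingEquiv.toRingHom (X i) = xiPoly k hn i := xiEquiv_X k hn i
      rw [chartVec_zero_succ, h, xiPoly, apply_ite ω, apply_ite ω]
      simp only [map_add, map_mul, map_pow, hωX, hωC, curveY, Fin.val_succ]
      split_ifs <;> first | contradiction | omega | (simp [he]; try field_simp)

/-- The generic point of the line is dense and is sent into the graph, so by continuity the whole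
curve, including its point over `t = 0`, lies in the closure. -/
lemma graphCurve_mem_closure (hn : 3 ≤ n) (y : ↥(Spec (LineRing k))) :
    graphCurve k hn y ∈ closure (Set.range (xiRep k hn).graphMap) := by
  let e : Polynomial k →+* FractionRing (Polynomial k) := algebraMap _ _
  have hi : Function.Injective e := IsFractionRing.injective _ _
  obtain ⟨p, hp⟩ := exists_comp_graphMap hn e (by
    rw [Ne, map_eq_zero_iff e hi]
    exact Polynomial.X_ne_zero)
  have hd : DenseRange (Spec.map (CommRingCat.ofHom e)) := by
    refine (PrimeSpectrum.denseRange_comap_iff_ker_le_nilRadical e).mpr ?_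
    rw [(RingHom.injective_iff_ker_eq_bot e).mp hi]
    exact bot_le
  have h1 := image_closure_subset_closure_image (graphCurve k hn).continuous ⟨y, hd y, rfl⟩
  refine closure_mono ?_ h1
  rintro _ ⟨_, ⟨x, rfl⟩, rfl⟩
  refine ⟨p x, ?_⟩
  rw [← Scheme.Hom.comp_apply, ← Scheme.Hom.comp_apply, hp]

end Limit

/-! ### The fibre at `t = 0` is not a graph. -/

section NotFlat

open MvPolynomial

variable {n : ℕ} {k : Type u} [Field k]

/-- At `t = 0`, the coordinates `x_2` and `x_3` of a point and of its image are proportional. -/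
lemma ratio_eq_of_graphMap (hn : 3 ≤ n) {B : Scheme.{u}} {g : B ⟶ Spec (LineRing k)}
    {L : Type u} [Field L] (p : Spec (.of L) ⟶ ((xiRep k hn).pull g).source.toScheme)
    {e : Polynomial k →+* L} (he : e Polynomial.X = 0)
    (hp : p ≫ ((xiRep k hn).pull g).source.ι ≫
      pullback.fst (g ≫ lineStr k) (ProjSpace.str n k) ≫ g = Spec.map (CommRingCat.ofHom e))
    {g₁ g₂ : ChartRing k (idx₃ hn) →+* L}
    (h₁ : p ≫ ((xiRep k hn).pull g).source.ι ≫
      pullback.snd (g ≫ lineStr k) (ProjSpace.str n k) =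
        Spec.map (CommRingCat.ofHom g₁) ≫ chartι k (idx₃ hn))
    (h₂ : p ≫ ((xiRep k hn).pull g).hom ≫
      pullback.snd (g ≫ lineStr k) (ProjSpace.str n k) =
        Spec.map (CommRingCat.ofHom g₂) ≫ chartι k (idx₃ hn)) :
    g₁ (ratio k (idx₃ hn) (idx₂ hn)) = g₂ (ratio k (idx₃ hn) (idx₂ hn)) := by
  obtain ⟨u, hu, hu₁, hu₂⟩ := exists_coordinates (isAffineRep_xiRep hn)
    (fun r ↦ (xiEquiv k hn).commutes r) g p
  have hue : u.comp C = e := by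
    have h := Spec.map_injective (hu.symm.trans hp)
    exact congr(($h).hom)
  have hu0 : u (C Polynomial.X) = 0 := (RingHom.congr_fun hue _).trans he
  obtain ⟨hv, rfl⟩ := projPoint_eq_comp_chartι (hu₁.symm.trans h₁)
  obtain ⟨hw, rfl⟩ := projPoint_eq_comp_chartι (hu₂.symm.trans h₂)
  have e₁ := mul_chartEval_ratio (u.comp (C.comp (baseHom (lineStr k))))
    (fun j ↦ u (chartVec n (Polynomial k) 0 j)) _ (idx₂ hn) hv
  have e₂ := mul_chartEval_ratio (u.comp (C.comp (baseHom (lineStr k))))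
    (fun j ↦ u ((xiEquiv k hn).toRingEquiv.toRingHom (chartVec n (Polynomial k) 0 j))) _ (idx₂ hn) hw
  have hX : ∀ i, (xiEquiv k hn).toRingEquiv.toRingHom (X i) = xiPoly k hn i := xiEquiv_X k hn
  have c₃ : chartVec n (Polynomial k) 0 (idx₃ hn) = X ⟨2, by omega⟩ :=
    chartVec_zero_succ _ (⟨2, by omega⟩ : Fin n)
  have c₂ : chartVec n (Polynomial k) 0 (idx₂ hn) = X ⟨1, by omega⟩ :=
    chartVec_zero_succ _ (⟨1, by omega⟩ : Fin n)
  have t₃ : u ((xiEquiv k hn).toRingEquiv.toRingHom (chartVec n (Polynomial k) 0 (idx₃ hn))) =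
      u (chartVec n (Polynomial k) 0 (idx₃ hn)) := by
    rw [c₃, hX]; simp [xiPoly]
  have t₂ : u ((xiEquiv k hn).toRingEquiv.toRingHom (chartVec n (Polynomial k) 0 (idx₂ hn))) =
      u (chartVec n (Polynomial k) 0 (idx₂ hn)) := by
    rw [c₂, hX]; simp [xiPoly, hu0]
  refine hv.mul_left_cancel (e₁.trans ?_)
  have e₃ := e₂.trans t₂
  exact e₃.symm.trans (congrArg (· * _) t₃)

/-- The fibre at `t = 0` of the closure of the graph of `ξ` is not contained in the closure of
the graph of a birational transformation. -/
lemma not_preimage_subset (hn : 3 ≤ n) {K : Type u} [Field K]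
    (g : Spec (.of K) ⟶ Spec (LineRing k)) (hg : param g = 0)
    (ψ : BirRep (ProjSpace.str n k) (g ≫ lineStr k)) :
    ¬ prodMap₂ (ProjSpace.str n k) (lineStr k) g ⁻¹'
      closure (Set.range (xiRep k hn).graphMap) ⊆ closure (Set.range ψ.graphMap) := by
  intro hsub
  let s' := g ≫ lineStr k
  let ρ := (xiRep k hn).pull g
  -- The open set of pairs in the chart `x_3 ≠ 0` whose ratios `x_2 / x_3` differ. The graph of
  -- `ξ(0)` misses it.
  obtain ⟨O, hO⟩ := exists_opens_ne
    (pullback.fst (pullback.fst s' (ProjSpace.str n k)) (pullback.fst s' (ProjSpace.str n k)) ≫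
      pullback.snd _ _)
    (pullback.snd (pullback.fst s' (ProjSpace.str n k)) (pullback.fst s' (ProjSpace.str n k)) ≫
      pullback.snd _ _) (chartι k (idx₃ hn)) (ratio k (idx₃ hn) (idx₂ hn))
  have hρ : Set.range ρ.graphMap ⊆ closure (Set.range ψ.graphMap) := by
    rintro _ ⟨x, rfl⟩
    refine hsub (subset_closure ⟨pullSourceMap (xiRep k hn) g x, ?_⟩)
    rw [← Scheme.Hom.comp_apply, ← Scheme.Hom.comp_apply, graphMap_pull]
  let y : ↥(Spec (.of K)) := Nonempty.some inferInstance
  have hX : ∀ j, (Spec.preimage g).hom (curveX n (Polynomial.X : Polynomial k) j) =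
      curveX n (0 : K) j := fun j ↦ (map_curveX _ _ _).trans (congrArg (curveX n · j) hg)
  have hY : ∀ j, (Spec.preimage g).hom (curveY n (Polynomial.X : Polynomial k) j) =
      curveY n (0 : K) j := fun j ↦ (map_curveY _ _ _).trans (congrArg (curveY n · j) hg)
  -- The limit pair `([0:0:0:1:0:…], [0:0:1:1:0:…])`, with ratios `0` and `1`.
  let P := biPoint (R := .of K) s' (isUnit_curveX hn (0 : K)) (isUnit_curveY hn (0 : K))
  have hP : P ≫ prodMap₂ (ProjSpace.str n k) (lineStr k) g = g ≫ graphCurve k hn := by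
    refine Eq.trans ?_ (biPoint_pull (R := LineRing k) (lineStr k)
      (isUnit_curveX hn (Polynomial.X : Polynomial k))
      (isUnit_curveY hn (Polynomial.X : Polynomial k)) g)
    simp only [hX, hY]
    rfl
  have hPψ : P y ∈ closure (Set.range ψ.graphMap) := by
    apply hsub
    rw [Set.mem_preimage, ← Scheme.Hom.comp_apply, hP]
    exact graphCurve_mem_closure hn (g y)
  have hPO : P y ∈ O := by
    refine (hO K P y).mpr ⟨_, _, (biPoint_fst_snd _ _ _).trans
      (projPoint_eq _ _ _ (idx₃ hn) (isUnit_curveX hn 0)), (biPoint_snd_snd _ _ _).trans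
      (projPoint_eq _ _ _ (idx₃ hn) (isUnit_curveY hn 0)), ?_⟩
    have e₁ := mul_chartEval_ratio (baseHom s') _ _ (idx₂ hn) (isUnit_curveX hn (0 : K))
    have e₂ := mul_chartEval_ratio (baseHom s') _ _ (idx₂ hn) (isUnit_curveY hn (0 : K))
    intro h
    rw [h] at e₁
    simp only [curveX, curveY] at e₁ e₂
    simp_all
  -- `O` is a neighbourhood of a point in the closure, so it contains a point of the graph of `ψ`
  -- itself. By irreducibility such a point can be chosen over the common domain of `ψ` and `ξ(0)`.
  obtain ⟨_, hzO, x₀, rfl⟩ := mem_closure_iff.mp hPψ O O.2 hPO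
  have hirr : IrreducibleSpace ↥(pullback s' (ProjSpace.str n k)) :=
    irreducibleSpace_prod (R := .of K) s'
  obtain ⟨r₀, -⟩ := ρ.surj_source.surj y
  obtain ⟨x, hxρ, x', hx'O, rfl⟩ := nonempty_preirreducible_inter ρ.source.2
    (ψ.source.ι.isOpenEmbedding.isOpenMap _ (ψ.graphMap ⁻¹ᵁ O).2) ⟨r₀.1, r₀.2⟩
    ⟨_, x₀, hzO, rfl⟩
  let x₁ : ρ.source.toScheme := ⟨ψ.source.ι x', hxρ⟩
  have hx₁ : pullback.fst (pullback.fst s' (ProjSpace.str n k))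
      (pullback.fst s' (ProjSpace.str n k)) (ρ.graphMap x₁) = ψ.source.ι x' := by
    rw [← Scheme.Hom.comp_apply, graphMap_fst]
    rfl
  -- Over the domain of `ψ` its graph is already closed, so the two graphs have the same point over
  -- `x'`; thus the graph of `ξ(0)` meets `O`.
  obtain ⟨x₂, hx₂⟩ := mem_range_graphMap ψ (hρ ⟨x₁, rfl⟩) (by rw [hx₁]; exact x'.2)
  have hx₂' : x₂ = x' := by
    apply ψ.source.ι.isOpenEmbedding.injective
    rw [← hx₁, ← hx₂, ← Scheme.Hom.comp_apply, graphMap_fst]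
  subst hx₂'
  let L := ρ.source.toScheme.residueField x₁
  let p : Spec (.of L) ⟶ ρ.source.toScheme := ρ.source.toScheme.fromSpecResidueField x₁
  let y' : ↥(Spec (.of L)) := Nonempty.some inferInstance
  have hz : (p ≫ ρ.graphMap) y' ∈ O := by
    rw [Scheme.Hom.comp_apply, Scheme.fromSpecResidueField_apply, ← hx₂]
    exact hx'O
  obtain ⟨g₁, g₂, h₁, h₂, hne⟩ := (hO L (p ≫ ρ.graphMap) y').mp hz
  rw [Category.assoc, reassoc_of% graphMap_fst] at h₁
  rw [Category.assoc, reassoc_of% graphMap_snd] at h₂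
  let q : Spec (.of L) ⟶ Spec (.of K) := p ≫ ρ.source.ι ≫ pullback.fst s' (ProjSpace.str n k)
  refine hne (ratio_eq_of_graphMap hn p (e := (Spec.preimage (q ≫ g)).hom) ?_ ?_ h₁ h₂)
  · rw [Spec.preimage_comp]
    exact (congrArg (Spec.preimage q).hom hg).trans (map_zero _)
  · rw [CommRingCat.ofHom_hom, Spec.map_preimage]
    simp only [q, Category.assoc]
    rfl

lemma xi_notMem_birFlat (hn : 3 ≤ n) :
    Bir.mk (xiRep k hn) ∉ birFlat (ProjSpace.str n k) (lineStr k) := by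
  rintro ⟨φ, hφ, -, hfib⟩
  have hp : (Ideal.span {(Polynomial.X : Polynomial k)}).IsPrime :=
    (Ideal.span_singleton_prime Polynomial.X_ne_zero).mpr Polynomial.prime_X
  let a : ↥(Spec (LineRing k)) := ⟨Ideal.span {(Polynomial.X : Polynomial k)}, hp⟩
  obtain ⟨ψ, hψ⟩ := hfib a
  let K : Type u := (Spec (LineRing k)).residueField a
  let g : Spec (.of K) ⟶ Spec (LineRing k) := (Spec (LineRing k)).fromSpecResidueField a
  have hg : param g = 0 :=
    (param_fromSpecResidueField a).mpr (Ideal.mem_span_singleton_self _)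
  let ψ' : BirRep (ProjSpace.str n k) (g ≫ lineStr k) := ψ
  have hψ' : φ.graph.comap (prodMap₂ (ProjSpace.str n k) (lineStr k) g) = ψ'.graph := hψ
  refine not_preimage_subset hn g hg ψ' ?_
  have : IsLocallyNoetherian (pullback (g ≫ lineStr k) (ProjSpace.str n k)) :=
    LocallyOfFiniteType.isLocallyNoetherian (pullback.fst (g ≫ lineStr k) (ProjSpace.str n k))
  rw [← support_graph ψ', ← hψ', Scheme.IdealSheafData.support_comap]
  have : IrreducibleSpace ↥(pullback (lineStr k) (ProjSpace.str n k)) :=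
    irreducibleSpace_prod (R := LineRing k) _
  refine Set.preimage_mono (f := prodMap₂ (ProjSpace.str n k) (lineStr k) g)
    (t := (φ.graph.support : Set _)) ?_
  rw [← closure_range_graphMap_eq hφ]
  -- Only the inclusion of the closure in the support is needed on this side, and it holds for any
  -- morphism; equality was needed for `ψ'`.
  exact closure_minimal φ.graphMap.range_subset_ker_support φ.graph.support.2

end NotFlat

end BirFamilies

end

open BirFamilies in
theorem mainTheorem3 (k : Type u) [Field k] [IsAlgClosed k] (n : ℕ) (hn : 3 ≤ n) :
    (∃ ξ : Bir (ProjSpace.str n k) (Line.str k),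
      ExtendsAffineFamily ξ (xiPoly k hn) ∧
      (∀ t : k, HasDegree (ξ.pull (Line.pt t)) 2) ∧
      (∀ t : k, t ≠ 0 → HasDegree (ξ.pull (Line.pt t)).inv 4) ∧
      HasDegree (ξ.pull (Line.pt (0 : k))).inv 2 ∧
      ξ ∈ birDeg (Line.str k) ∧
      ξ.inv ∉ birDeg (Line.str k) ∧
      ξ ∉ birFlat (ProjSpace.str n k) (Line.str k)) ∧
    ¬ ∀ (A : Scheme.{u}) (πA : A ⟶ Spec (.of k)), IsLocallyNoetherian A →
      birFlat (ProjSpace.str n k) πA = birDeg πA := by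
  constructor
  · refine ⟨Bir.mk (xiRep k hn), extendsAffineFamily_xiRep hn, fun t ↦ ?_, fun t ht ↦ ?_, ?_,
      xi_mem_birDeg hn, xi_inv_notMem_birDeg hn, xi_notMem_birFlat hn⟩
    · exact hasDegree_xi hn (Field.toIsField k) (linePt t)
    · exact hasDegree_xi_pull_inv hn (Field.toIsField k) (linePt t) (by rwa [param_linePt])
    · exact hasDegree_xi_pull_inv_zero hn (Field.toIsField k) (linePt 0) (param_linePt 0)
  · intro h
    have : IsLocallyNoetherian (Line k) :=
      inferInstanceAs (IsLocallyNoetherian (Spec (LineRing k)))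
    -- The line separates the two functors: `ξ` has constant degree but its graph is not a flat
    -- family.
    exact xi_notMem_birFlat hn (h (Line k) (Line.str k) this ▸ xi_mem_birDeg hn)
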